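/- **Setting.** Let $s>2c\ge 0$ be integers and let $\mu,\nu$ be mutually absolutely continuous probability measures on $\mathbb R$ such that $\log\frac{d\mu}{d\nu}$ is integrable with respect to both and $I_1=\int\log\frac{d\mu}{d\nu}\,d\mu>0$, $I_0=-\int\log\frac{d\mu}{d\nu}\,d\nu>0$. Put $I=\min\{I_0,I_1\}$. The state is $\theta\in\{0,1\}$, and the observations $x_i(k)$ of the sensors $i\in\{1,\dots,s\}$ at the times $k=1,2,\dots$ are i.i.d. with law $\nu$ if $\theta=0$ and law $\mu$ if $\theta=1$. **Attacks.** An admissible attack $g$ fixes, for each state $\theta$, a set $\mathcal C_\theta$ of $c$ compromised sensors, and at each time $k$ adds to the observation vector $x(k)$ a bias vector $x^a(k)\in\mathbb R^s$ that vanishes outside $\mathcal C_\theta$. The bias is a measurable function of the observations of the compromised sensors up to time $k$, the earlier bias vectors, $\theta$, $k$, and private randomness of the attacker that is independent of the observations. The detector receives $x'(k)=x(k)+x^a(k)$. **Detectors.** A (possibly randomized) sequential detector decides at each time $k$, measurably from $x'(1),\dots,x'(k)$ and independent private randomness, whether to continue or to stop and accept $\theta=0$ or $\theta=1$. Let $T\in\{1,2,\dots,\infty\}$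 be its stopping time, $D(T)=\max_{\theta}\mathbb E^g_\theta[T]\in[1,\infty]$, and let $\alpha$ (respectively $\beta$) be the probability that it stops and accepts $1$ when $\theta=0$ (respectively accepts $0$ when $\theta=1$). A detection strategy $f$ is a family of detectors indexed by an arbitrary parameter set. Its performance against $g$ is $$\gamma(f,g)=\lim_{\alpha=\beta\to0^+}\frac{\log(1/\alpha)}{D(T)},$$ the limit being taken over those parameters for which $\alpha=\beta>0$, as this common value tends to $0$ (the ratio is $0$ if $D(T)=\infty$). Write $\overline\gamma(f,g)$ and $\underline\gamma(f,g)$ for the corresponding upper and lower limits. **The strategies.** The voting strategy $f^*=f^{(s-c)}$, indexed by $a,b>0$, computes $S_i(n)=\sum_{k\le n}\log\frac{d\mu}{d\nu}(x'_i(k))$ for each sensor and stops at the first time by which at least $s-c$ of the sensors have had $S_i\le -a$ at some time (it then accepts $0$) or at least $s-c$ of the sensors have had $S_i\ge b$ at some time (it then accepts $1$); if both happen for the first time at the same time, it tosses a fair coin. The flip attack $g^*$ replaces the observations of sensors $1,\dots,c$ by independent draws from $\mu$ if $\theta=0$, and those of sensors $s-c+1,\dots,s$ by independent draws from $\nu$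 if $\theta=1$. **Theorem.** The pair $(f^*,g^*)$ is a Nash equilibrium with value $(s-2c)I$: for every detection strategy $f$ and every admissible attack $g$, $$\overline\gamma(f,g^*)\;\le\;\gamma(f^*,g^*)=(s-2c)\,I\;\le\;\underline\gamma(f^*,g).$$ Moreover, so that the claim has content even where $\alpha=\beta$ cannot be attained exactly, the following holds for the ratio $\log(1/\max\{\alpha,\beta\})/D(T)$. Its upper limit as $\max\{\alpha,\beta\}\to0^+$ is at most $(s-2c)I$ for every $f$ against $g^*$. For $f^*$ with equal thresholds $a=b\to\infty$, one has $\max\{\alpha,\beta\}\to0^+$ against every admissible attack $g$, the lower limit of the ratio is at least $(s-2c)I$ for every $g$, and the limit exists and equals $(s-2c)I$ for $g=g^*$. -/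

import Mathlib

open MeasureTheory ProbabilityTheory Filter Topology
open scoped ENNReal

namespace ByzantineDetection

noncomputable section

/-! ### The observation model

The state `θ` is a Boolean (`false` is `θ = 0`, `true` is `θ = 1`), the sensors are `Fin s`, and a
sequence of observations is `x : ℕ → Fin s → ℝ`, where index `k` stands for time `k + 1`. -/

/-- The law of one observation: `ν` if `θ = 0` and `μ` if `θ = 1`. -/
def stateLaw (μ ν : Measure ℝ) : Bool → Measure ℝ
  | false => ν
  | true => μ

instance (μ ν : Measure ℝ) [IsProbabilityMeasure μ] [IsProbabilityMeasure ν] (θ : Bool) :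
    IsProbabilityMeasure (stateLaw μ ν θ) := by
  cases θ <;> simpa [stateLaw]

/-- The law of a family of real random variables, indexed by times and sensors, that are all
independent with the same law `ρ`. -/
def iidLaw (s : ℕ) (ρ : Measure ℝ) [IsProbabilityMeasure ρ] : Measure (ℕ → Fin s → ℝ) :=
  Measure.infinitePi fun _ : ℕ => Measure.pi fun _ : Fin s => ρ

instance (s : ℕ) (ρ : Measure ℝ) [IsProbabilityMeasure ρ] :
    IsProbabilityMeasure (iidLaw s ρ) := by
  unfold iidLaw; infer_instance

/-- Kullback–Leibler divergence `I₁ = ∫ log (dμ/dν) dμ`. -/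
def klOne (μ ν : Measure ℝ) : ℝ := ∫ x, llr μ ν x ∂μ

/-- Kullback–Leibler divergence `I₀ = - ∫ log (dμ/dν) dν`. -/
def klZero (μ ν : Measure ℝ) : ℝ := -∫ x, llr μ ν x ∂ν

/-- The number `(s - 2c) · min {I₀, I₁}`. -/
def gameValue (μ ν : Measure ℝ) (s c : ℕ) : ℝ≥0∞ :=
  ENNReal.ofReal (((s : ℝ) - 2 * c) * min (klZero μ ν) (klOne μ ν))

/-! ### Attacks -/

/-- An admissible attack on `c` out of `s` sensors. For each state there is a fixed set of `c`
compromised sensors, and the bias vector at each time is a measurable function of the true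
observations of the compromised sensors up to the present, of the earlier bias vectors, of the
state, of the time, and of private randomness (independent of the observations); it vanishes
at the honest sensors. -/
structure Attack (s c : ℕ) where
  /-- the compromised sensors -/
  comp : Bool → Finset (Fin s)
  card_comp : ∀ θ, (comp θ).card = c
  /-- the space of private randomness of the attacker -/
  Aux : Type
  [mAux : MeasurableSpace Aux]
  /-- the law of the private randomness -/
  auxLaw : Bool → Measure Aux
  [probAux : ∀ θ, IsProbabilityMeasure (auxLaw θ)]
  /-- the bias vector at time `k + 1` -/
  bias : (θ : Bool) → (k : ℕ) → Aux → (Fin (k + 1) → comp θ → ℝ) → (Fin k → Fin s → ℝ) →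
    Fin s → ℝ
  measurable_bias : ∀ θ k, Measurable
    fun p : Aux × (Fin (k + 1) → comp θ → ℝ) × (Fin k → Fin s → ℝ) => bias θ k p.1 p.2.1 p.2.2
  bias_honest : ∀ θ k v X Xa, ∀ i ∉ comp θ, bias θ k v X Xa i = 0

attribute [instance] Attack.mAux Attack.probAux

/-- The sequence of bias vectors produced by the attack `g` from the true observations `x`, when
the private randomness is `v`. -/
def biasSeq {s c : ℕ} (g : Attack s c) (θ : Bool) (v : g.Aux) (x : ℕ → Fin s → ℝ) (k : ℕ) :
    Fin s → ℝ :=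
  g.bias θ k v (fun j i => x j i) (fun j : Fin k => biasSeq g θ v x j)
termination_by k
decreasing_by exact j.2

/-- The observations received by the fusion center. -/
def received {s c : ℕ} (g : Attack s c) (θ : Bool) (v : g.Aux) (x : ℕ → Fin s → ℝ) (k : ℕ) :
    Fin s → ℝ :=
  x k + biasSeq g θ v x k

/-! ### Detectors -/

/-- A (possibly randomized) sequential detector. At time `k + 1` it looks at the received
observations up to that time and at private randomness (independent of everything else), and
either continues (`none`) or stops and accepts the hypothesis `θ = d` (`some d`). -/
structure Detector (s : ℕ) where
  /-- the space of private randomness of the detector -/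
  Aux : Type
  [mAux : MeasurableSpace Aux]
  /-- the law of the private randomness -/
  auxLaw : Measure Aux
  [probAux : IsProbabilityMeasure auxLaw]
  /-- the decision at time `k + 1` -/
  rule : (k : ℕ) → (Fin (k + 1) → Fin s → ℝ) → Aux → Option Bool
  measurable_rule : ∀ k d, MeasurableSet
    {p : (Fin (k + 1) → Fin s → ℝ) × Aux | rule k p.1 p.2 = d}

attribute [instance] Detector.mAux Detector.probAux

/-- The decision of `f` at time `k + 1` when the received sequence is `y`. -/
def Detector.at {s : ℕ} (f : Detector s) (u : f.Aux) (y : ℕ → Fin s → ℝ) (k : ℕ) : Option Bool :=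
  f.rule k (fun j i => y j i) u

/-- The time `T ∈ {1, 2, …, ∞}` at which the detector stops. -/
def Detector.stopTime {s : ℕ} (f : Detector s) (u : f.Aux) (y : ℕ → Fin s → ℝ) : ℕ∞ :=
  ⨅ (k : ℕ) (_ : f.at u y k ≠ none), ((k + 1 : ℕ) : ℕ∞)

/-- The detector stops at a finite time and accepts `d`. -/
def Detector.Accepts {s : ℕ} (f : Detector s) (u : f.Aux) (y : ℕ → Fin s → ℝ) (d : Bool) : Prop :=
  ∃ k, f.at u y k = some d ∧ ∀ j < k, f.at u y j = none

/-! ### Performance -/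

section Performance

variable (μ ν : Measure ℝ) [IsProbabilityMeasure μ] [IsProbabilityMeasure ν] {s c : ℕ}

/-- The joint law, in the state `θ`, of the true observations, the private randomness of the
attacker and the private randomness of the detector, which are independent. -/
def jointLaw (f : Detector s) (g : Attack s c) (θ : Bool) :
    Measure ((ℕ → Fin s → ℝ) × g.Aux × f.Aux) :=
  (iidLaw s (stateLaw μ ν θ)).prod ((g.auxLaw θ).prod f.auxLaw)

/-- The probability that the detector accepts `d` when the state is `θ`. -/
def acceptProb (f : Detector s) (g : Attack s c) (θ d : Bool) : ℝ :=
  (jointLaw μ ν f g θ).real {ω | f.Accepts ω.2.2 (received g θ ω.2.1 ω.1) d}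

/-- The probability `α` of a type-I error. -/
def typeI (f : Detector s) (g : Attack s c) : ℝ := acceptProb μ ν f g false true

/-- The probability `β` of a type-II error. -/
def typeII (f : Detector s) (g : Attack s c) : ℝ := acceptProb μ ν f g true false

/-- The expected stopping time in the state `θ`. -/
def meanTime (f : Detector s) (g : Attack s c) (θ : Bool) : ℝ≥0∞ :=
  ∫⁻ ω, (f.stopTime ω.2.2 (received g θ ω.2.1 ω.1) : ℝ≥0∞) ∂jointLaw μ ν f g θ

/-- The detection delay `D(T)`. -/
def delay (f : Detector s) (g : Attack s c) : ℝ≥0∞ :=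
  max (meanTime μ ν f g false) (meanTime μ ν f g true)

/-- The error level `max α β`, which is `α` when `α = β`. -/
def errorLevel (f : Detector s) (g : Attack s c) : ℝ := max (typeI μ ν f g) (typeII μ ν f g)

/-- The ratio `log (1/α) / D(T)`, where, if the two error probabilities differ, the larger one is
taken for `α`. It is `0` if the delay is infinite. -/
def perfRatio (f : Detector s) (g : Attack s c) : ℝ≥0∞ :=
  ENNReal.ofReal (Real.log (1 / errorLevel μ ν f g)) / delay μ ν f g

/-- The limit `α = β → 0⁺` over the parameters of a family of detectors, facing the attack `g`. -/
def equalErrors {P : Type*} (f : P → Detector s) (g : Attack s c) : Filter P :=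
  comap (fun p => typeI μ ν (f p) g) (𝓝[>] 0) ⊓ 𝓟 {p | typeI μ ν (f p) g = typeII μ ν (f p) g}

/-- The limit `max α β → 0⁺` over the parameters of a family of detectors, facing the attack `g`. -/
def smallErrors {P : Type*} (f : P → Detector s) (g : Attack s c) : Filter P :=
  comap (fun p => errorLevel μ ν (f p) g) (𝓝[>] 0)

end Performance

/-! ### The flip attack -/

/-- The sensors whose distribution is flipped: the first `c` ones in the state `0` and the last `c`
ones in the state `1`. -/
def flipped (s c : ℕ) : Bool → Finset (Fin s)
  | false => Finset.univ.filter fun i => (i : ℕ) < c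
  | true => Finset.univ.filter fun i => s - c ≤ (i : ℕ)

lemma card_flipped {s c : ℕ} (h : 2 * c < s) (θ : Bool) : (flipped s c θ).card = c := by
  cases θ
  · rw [flipped, Fin.card_filter_val_lt]; omega
  · have h1 := Finset.card_filter_add_card_filter_not (s := (Finset.univ : Finset (Fin s)))
      (fun i : Fin s => (i : ℕ) < s - c)
    rw [Fin.card_filter_val_lt, Finset.card_univ, Fintype.card_fin] at h1
    simp only [not_lt] at h1
    rw [flipped]
    omega

/-- The flip attack: the observations of the flipped sensors are replaced by independent draws
from the opposite distribution. -/
def flipAttack (μ ν : Measure ℝ) [IsProbabilityMeasure μ] [IsProbabilityMeasure ν] {s c : ℕ}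
    (h : 2 * c < s) : Attack s c where
  comp := flipped s c
  card_comp := card_flipped h
  Aux := ℕ → Fin s → ℝ
  auxLaw θ := iidLaw s (stateLaw μ ν (!θ))
  bias θ k v X _ i := if hi : i ∈ flipped s c θ then v k i - X (Fin.last k) ⟨i, hi⟩ else 0
  measurable_bias θ k := by
    refine measurable_pi_iff.2 fun i => ?_
    by_cases hi : i ∈ flipped s c θ
    · simp only [hi, dite_true]; fun_prop
    · simp only [hi, dite_false]; fun_prop
  bias_honest θ k v X Xa i hi := by simp [hi]

/-! ### The voting detector -/

section Voting

variable (μ ν : Measure ℝ) {s : ℕ}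

/-- The cumulative log-likelihood ratio `S_i` of sensor `i` at time `j + 1`. -/
def cumLLR {k : ℕ} (y : Fin (k + 1) → Fin s → ℝ) (i : Fin s) (j : Fin (k + 1)) : ℝ :=
  ∑ l ∈ Finset.Iic j, llr μ ν (y l i)

open Classical in
/-- The number of sensors `i` such that `S_i ≥ b` at some time up to the present. The
`r`-th smallest of the first passage times over `b` has come when this number is at least `r`. -/
def upVotes {k : ℕ} (b : ℝ) (y : Fin (k + 1) → Fin s → ℝ) : ℕ :=
  (Finset.univ.filter fun i => ∃ j, b ≤ cumLLR μ ν y i j).card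

open Classical in
/-- The number of sensors `i` such that `S_i ≤ -a` at some time up to the present. -/
def downVotes {k : ℕ} (a : ℝ) (y : Fin (k + 1) → Fin s → ℝ) : ℕ :=
  (Finset.univ.filter fun i => ∃ j, cumLLR μ ν y i j ≤ -a).card

/-- The decision of the voting rule; in a tie it is given by the coin. -/
def voteRule (r : ℕ) (a b : ℝ) {k : ℕ} (y : Fin (k + 1) → Fin s → ℝ) (coin : Bool) : Option Bool :=
  if r ≤ downVotes μ ν a y then
    if r ≤ upVotes μ ν b y then some coin else some false
  else
    if r ≤ upVotes μ ν b y then some true else none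

lemma measurable_cumLLR {k : ℕ} (i : Fin s) (j : Fin (k + 1)) :
    Measurable fun y : Fin (k + 1) → Fin s → ℝ => cumLLR μ ν y i j := by
  unfold cumLLR
  refine Finset.measurable_sum _ fun l _ => (measurable_llr μ ν).comp ?_
  fun_prop

lemma measurable_upVotes {k : ℕ} (b : ℝ) :
    Measurable fun y : Fin (k + 1) → Fin s → ℝ => upVotes μ ν b y := by
  classical
  simp only [upVotes, Finset.card_filter]
  refine Finset.measurable_sum _ fun i _ => Measurable.ite ?_ measurable_const measurable_const
  simp only [Set.ofPred_exists]
  exact MeasurableSet.iUnion fun j => measurableSet_le measurable_const (measurable_cumLLR μ ν i j)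

lemma measurable_downVotes {k : ℕ} (a : ℝ) :
    Measurable fun y : Fin (k + 1) → Fin s → ℝ => downVotes μ ν a y := by
  classical
  simp only [downVotes, Finset.card_filter]
  refine Finset.measurable_sum _ fun i _ => Measurable.ite ?_ measurable_const measurable_const
  simp only [Set.ofPred_exists]
  exact MeasurableSet.iUnion fun j => measurableSet_le (measurable_cumLLR μ ν i j) measurable_const

lemma measurable_voteRule (r : ℕ) (a b : ℝ) (k : ℕ) (d : Option Bool) :
    MeasurableSet {p : (Fin (k + 1) → Fin s → ℝ) × Bool | voteRule μ ν r a b p.1 p.2 = d} := by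
  have h : (fun p : (Fin (k + 1) → Fin s → ℝ) × Bool => voteRule μ ν r a b p.1 p.2) =
      (fun q : ℕ × ℕ × Bool => if r ≤ q.1 then (if r ≤ q.2.1 then some q.2.2 else some false)
        else (if r ≤ q.2.1 then some true else none)) ∘
      fun p => (downVotes μ ν a p.1, upVotes μ ν b p.1, p.2) := rfl
  change MeasurableSet ((fun p : (Fin (k + 1) → Fin s → ℝ) × Bool =>
    voteRule μ ν r a b p.1 p.2) ⁻¹' {d})
  rw [h, Set.preimage_comp]
  exact (((measurable_downVotes μ ν a).comp measurable_fst).prodMk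
    (((measurable_upVotes μ ν b).comp measurable_fst).prodMk measurable_snd))
    (MeasurableSet.of_discrete)

/-- The voting detector `f^{(r)}` with thresholds `-a` and `b`: it stops at the first time when the
cumulative log-likelihood ratios of `r` sensors have crossed the same threshold and accepts the
corresponding hypothesis, and tosses a fair coin if this happens for both thresholds at once. -/
def votingDetector (r : ℕ) (a b : ℝ) : Detector s where
  Aux := Bool
  auxLaw := (PMF.uniformOfFintype Bool).toMeasure
  rule _ y coin := voteRule μ ν r a b y coin
  measurable_rule := measurable_voteRule μ ν r a b

end Voting

/-- The pairs `(a, b)` of positive numbers, which determine thresholds `-a < 0 < b`. -/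
abbrev Thresholds : Type := {p : ℝ × ℝ // 0 < p.1 ∧ 0 < p.2}

/-- The detection strategy `f* = f^{(s-c)}`, a family indexed by the thresholds. -/
def votingStrategy (μ ν : Measure ℝ) (s c : ℕ) (p : Thresholds) : Detector s :=
  votingDetector μ ν (s - c) p.1.1 p.1.2

end

end ByzantineDetection

open ByzantineDetection

/-! Upper bound. Under the flip attack the first `c` sensors show `μ` and the last `c` sensors show
`ν` in both states, so only the `s - 2c` middle sensors carry information. The detector faces an
i.i.d. sequence whose divergence per step is `(s - 2c) I_θ`. For any sequential test with both
errors at most `e`, a Wald-type inequality gives `(1 - e) log (1/e) - 1 ≤ (s - 2c) I_θ E_θ[T]`. It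
comes from integrating `1 + u ≤ exp u` at `u = t - L`, where `L` is the log-likelihood ratio when
the test stops (`one_add_mul_measureReal_le`), and from telescoping over time
(`sum_measureReal_stop_le`). The case of `t = log (1/e)` is `log_mul_one_sub_acceptProb_le`.
Dividing by the delay and letting `e → 0` bounds every strategy (`limsup_perfRatio_flipAttack_le`).

Lower bound. A wrong decision of the voting rule needs `s - c` votes, at least `s - 2c` of them from
honest sensors. By Ville's inequality an honest sensor ever casts a wrong vote at threshold `b` with
probability at most `exp (-b)`. Independence and a union bound over sets of sensors give an error of
at most a constant times `exp (-(s - 2c) b)`, whatever the attack (`acceptProb_voting_le`). On the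
other hand the honest sensors alone suffice for a correct decision, so the rule has stopped once all
of them have crossed the correct threshold. For thresholds at most `M`, each crossing time exceeds
`M / I_θ`, up to rounding, by only `o(M)` in mean (`exists_tsum_notReached_le`). Even the latest
crossing thus costs `M / I + o(M)` (`exists_delay_voting_le`). The quotient of the exponents is `(s
- 2c) I`.

In the limit `α = β → 0` the two thresholds may differ. A bounded upper threshold keeps `α` away
from `0` (`exists_pos_le_typeI_voting`), so it must tend to infinity; and since the errors agree,
both are controlled by the larger threshold, which also governs the delay. -/

namespace ByzantineDetection

/-! ### Densities and independence for product measures on sequences. -/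

section ProductMeasures

variable {X : Type*} [MeasurableSpace X]

/-- On a box, the indicator of the box times the product density is a product of functions of
independent coordinates, so its integral factors. -/
lemma pi_withDensity {ι : Type*} [Fintype ι] (P : ι → Measure X)
    [∀ i, IsProbabilityMeasure (P i)] {f : ι → X → ℝ≥0∞} (hf : ∀ i, Measurable (f i))
    [∀ i, IsProbabilityMeasure ((P i).withDensity (f i))] :
    Measure.pi (fun i => (P i).withDensity (f i)) =
      (Measure.pi P).withDensity (fun x => ∏ i, f i (x i)) := by
  classical
  refine Measure.pi_eq fun t ht => ?_
  have hbox : MeasurableSet (Set.univ.pi t) := MeasurableSet.univ_pi ht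
  have hind : iIndepFun (fun i (x : ι → X) => (t i).indicator (f i) (x i)) (Measure.pi P) :=
    iIndepFun_pi (fun i => ((hf i).indicator (ht i)).aemeasurable)
  rw [withDensity_apply _ hbox, ← lintegral_indicator hbox]
  have hprod : (Set.univ.pi t).indicator (fun x : ι → X => ∏ i, f i (x i)) =
      fun x => ∏ i, (t i).indicator (f i) (x i) := by
    ext x
    by_cases hx : x ∈ Set.univ.pi t
    · rw [Set.indicator_of_mem hx]
      exact Finset.prod_congr rfl fun i _ => (Set.indicator_of_mem (hx i (Set.mem_univ i)) _).symm
    · rw [Set.indicator_of_notMem hx]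
      simp only [Set.mem_pi, Set.mem_univ, true_implies, not_forall] at hx
      obtain ⟨i, hi⟩ := hx
      exact (Finset.prod_eq_zero (Finset.mem_univ i) (Set.indicator_of_notMem hi _)).symm
  rw [hprod, lintegral_prod_eq_prod_lintegral_of_indepFun Finset.univ _ hind
    fun i => ((hf i).indicator (ht i)).comp (measurable_pi_apply i)]
  refine Finset.prod_congr rfl fun i _ => ?_
  rw [withDensity_apply _ (ht i), ← lintegral_indicator (ht i)]
  exact (measurePreserving_eval P i).lintegral_comp ((hf i).indicator (ht i))

/-- The first `n` terms of a sequence. -/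
def initial (n : ℕ) (x : ℕ → X) (j : Fin n) : X := x j

lemma measurable_initial (n : ℕ) : Measurable (initial (X := X) n) := by
  unfold initial; fun_prop

lemma map_initial_infinitePi (P : Measure X) [IsProbabilityMeasure P] (n : ℕ) :
    (Measure.infinitePi fun _ : ℕ => P).map (initial n) = Measure.pi fun _ : Fin n => P := by
  rw [← Measure.infinitePi_eq_pi]
  exact Measure.map_infinitePi_infinitePi_of_inj (P := fun _ : ℕ => P) Fin.val_injective

/-- The σ-algebra generated by the first `n` terms of a sequence. -/
@[reducible] def past (X : Type*) [MeasurableSpace X] (n : ℕ) : MeasurableSpace (ℕ → X) :=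
  MeasurableSpace.comap (initial n) inferInstance

lemma past_le (n : ℕ) : past X n ≤ MeasurableSpace.pi :=
  (measurable_initial n).comap_le

lemma measurable_past_initial (n : ℕ) : Measurable[past X n] (initial (X := X) n) :=
  comap_measurable _

lemma measurable_past_initial_of_le {m n : ℕ} (h : m ≤ n) :
    Measurable[past X n] (initial (X := X) m) := by
  have h1 : initial (X := X) m = (fun y (j : Fin m) => y (Fin.castLE h j)) ∘ initial n := rfl
  rw [h1]
  exact (by fun_prop : Measurable fun (y : Fin n → X) (j : Fin m) => y (Fin.castLE h j)).comp
    (measurable_past_initial n)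

lemma past_mono {m n : ℕ} (h : m ≤ n) : past X m ≤ past X n :=
  (measurable_past_initial_of_le h).comap_le

lemma measurable_past_apply {k n : ℕ} (h : k < n) :
    Measurable[past X n] fun x : ℕ → X => x k :=
  (measurable_pi_apply (⟨k, h⟩ : Fin n)).comp (measurable_past_initial n)

/-- The restriction to the past is essential: different i.i.d. laws on infinite sequences are
mutually singular, and only on finitely many terms does the product density exist. -/
lemma infinitePi_withDensity_past (P : Measure X) [IsProbabilityMeasure P] {f : X → ℝ≥0∞}
    (hf : Measurable f) [IsProbabilityMeasure (P.withDensity f)] {n : ℕ} {S : Set (ℕ → X)}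
    (hS : MeasurableSet[past X n] S) :
    (Measure.infinitePi fun _ : ℕ => P.withDensity f) S =
      ∫⁻ x in S, ∏ k ∈ Finset.range n, f (x k) ∂Measure.infinitePi fun _ : ℕ => P := by
  obtain ⟨B, hB, rfl⟩ := hS
  rw [← Measure.map_apply (measurable_initial n) hB, map_initial_infinitePi,
    pi_withDensity (fun _ : Fin n => P) (fun _ => hf), withDensity_apply _ hB,
    ← map_initial_infinitePi, setLIntegral_map hB (by fun_prop) (measurable_initial n)]
  refine lintegral_congr fun x => ?_
  rw [Finset.prod_range]
  rfl

lemma indepFun_initial_apply (P : Measure X) [IsProbabilityMeasure P] (n : ℕ) :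
    IndepFun (initial (X := X) n) (fun x => x n) (Measure.infinitePi fun _ : ℕ => P) := by
  have h : iIndepFun (fun (k : ℕ) (x : ℕ → X) => x k) (Measure.infinitePi fun _ : ℕ => P) :=
    iIndepFun_infinitePi (X := fun _ x => x) (fun _ => measurable_id)
  have h2 := h.indepFun_finset (Finset.range n) {n} (by simp) (fun k => measurable_pi_apply k)
  exact h2.comp (φ := fun (y : Finset.range n → X) (j : Fin n) =>
      y ⟨j, Finset.mem_range.2 j.2⟩) (ψ := fun y : ({n} : Finset ℕ) → X => y ⟨n, by simp⟩)
    (by fun_prop) (by fun_prop)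

/-- The next term is independent of the past. This replaces optional stopping both in the lower
bound on testing times and in the upper bound on passage times. -/
lemma setIntegral_past_apply (P : Measure X) [IsProbabilityMeasure P] {φ : X → ℝ}
    (hφ : Measurable φ) {n : ℕ} {S : Set (ℕ → X)} (hS : MeasurableSet[past X n] S) :
    ∫ x in S, φ (x n) ∂(Measure.infinitePi fun _ : ℕ => P) =
      (Measure.infinitePi fun _ : ℕ => P).real S * ∫ y, φ y ∂P := by
  have hS' := past_le n S hS
  obtain ⟨B, hB, rfl⟩ := hS
  have hB1 : Measurable (B.indicator fun _ => (1 : ℝ)) := measurable_const.indicator hB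
  have h := (indepFun_initial_apply P n).comp hB1 hφ
  have h2 := h.integral_mul_eq_mul_integral
    ((hB1.comp (measurable_initial n)).aestronglyMeasurable)
    ((hφ.comp (measurable_pi_apply n)).aestronglyMeasurable)
  have h3 : ∫ x, φ (x n) ∂(Measure.infinitePi fun _ : ℕ => P) = ∫ y, φ y ∂P :=
    (measurePreserving_eval_infinitePi (fun _ : ℕ => P) n).hasLaw.integral_comp
      hφ.aestronglyMeasurable
  rw [← integral_indicator hS']
  have h4 : (initial (X := X) n ⁻¹' B).indicator (fun x => φ (x n)) =
      ((B.indicator fun _ => (1 : ℝ)) ∘ initial n) * (φ ∘ fun x => x n) := by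
    ext x
    by_cases hx : initial n x ∈ B
    · simp [Set.indicator, hx]
    · simp [Set.indicator, hx]
  rw [h4, h2]
  congr 1
  have h5 : (B.indicator fun _ => (1 : ℝ)) ∘ initial n =
      (initial (X := X) n ⁻¹' B).indicator fun _ => (1 : ℝ) := rfl
  rw [h5, integral_indicator hS']
  simp

lemma integrable_comp_apply {P : Measure X} [IsProbabilityMeasure P] {φ : X → ℝ}
    (hφ : Integrable φ P) (n : ℕ) :
    Integrable (fun x => φ (x n)) (Measure.infinitePi fun _ : ℕ => P) :=
  (measurePreserving_eval_infinitePi (fun _ : ℕ => P) n).integrable_comp_of_integrable hφ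

end ProductMeasures

/-! ### Independence across sensors and replacement of sensors. -/

section Sensors

lemma map_curry_infinitePi {s : ℕ} (ρ : Fin s → Measure ℝ) [∀ i, IsProbabilityMeasure (ρ i)] :
    (Measure.infinitePi fun p : ℕ × Fin s => ρ p.2).map (fun x k i => x (k, i)) =
      Measure.infinitePi fun _ : ℕ => Measure.pi ρ := by
  have h := Measure.infinitePi_map_curry (fun (_ : ℕ) (i : Fin s) => ρ i)
  simp only [Measure.infinitePi_eq_pi] at h
  exact h

lemma iidLaw_eq_map {s : ℕ} (ρ : Measure ℝ) [IsProbabilityMeasure ρ] :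
    iidLaw s ρ = (Measure.infinitePi fun _ : ℕ × Fin s => ρ).map (fun x k i => x (k, i)) :=
  (map_curry_infinitePi fun _ : Fin s => ρ).symm

/-- Grouping the same independent family by sensor instead of by time shows that the whole
trajectories of different sensors are independent. -/
lemma map_swap_iidLaw {s : ℕ} (ρ : Measure ℝ) [IsProbabilityMeasure ρ] :
    (iidLaw s ρ).map (fun x i k => x k i) =
      Measure.infinitePi fun _ : Fin s => Measure.infinitePi fun _ : ℕ => ρ := by
  have h := Measure.infinitePi_map_curry (fun (_ : Fin s) (_ : ℕ) => ρ)
  have h2 := Measure.map_infinitePi_infinitePi_of_inj (P := fun _ : ℕ × Fin s => ρ)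
    (Prod.swap_injective (α := Fin s) (β := ℕ))
  rw [← h, ← h2, iidLaw_eq_map, Measure.map_map (by fun_prop) (by fun_prop),
    Measure.map_map (by fun_prop) (by fun_prop)]
  rfl

lemma iidLaw_forall_mem {s : ℕ} (ρ : Measure ℝ) [IsProbabilityMeasure ρ] (A : Finset (Fin s))
    {E : Set (ℕ → ℝ)} (hE : MeasurableSet E) :
    iidLaw s ρ {x | ∀ i ∈ A, (fun k => x k i) ∈ E} =
      (Measure.infinitePi fun _ : ℕ => ρ) E ^ A.card := by
  have h := Measure.infinitePi_pi (μ := fun _ : Fin s => Measure.infinitePi fun _ : ℕ => ρ)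
    (s := A) (t := fun _ => E) (fun _ _ => hE)
  rw [Finset.prod_const] at h
  rw [← h, ← map_swap_iidLaw, Measure.map_apply (by fun_prop)
    (MeasurableSet.pi A.countable_toSet fun _ _ => hE)]
  rfl

lemma measurePreserving_sensor {s : ℕ} (ρ : Measure ℝ) [IsProbabilityMeasure ρ] (i : Fin s) :
    MeasurePreserving (fun x : ℕ → Fin s → ℝ => fun k => x k i) (iidLaw s ρ)
      (Measure.infinitePi fun _ : ℕ => ρ) := by
  refine ⟨by fun_prop, ?_⟩
  rw [← Measure.infinitePi_map_eval
      (fun _ : Fin s => Measure.infinitePi fun _ : ℕ => ρ) i, ← map_swap_iidLaw,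
    Measure.map_map (by fun_prop) (by fun_prop)]
  rfl

lemma iidLaw_forall_lt_mem {s : ℕ} (ρ : Measure ℝ) [IsProbabilityMeasure ρ] (n : ℕ)
    {E : Set ℝ} (hE : MeasurableSet E) :
    iidLaw s ρ {x | ∀ k < n, ∀ i, x k i ∈ E} = (ρ E ^ s) ^ n := by
  have h := Measure.infinitePi_pi (μ := fun _ : ℕ => Measure.pi fun _ : Fin s => ρ)
    (s := Finset.range n) (t := fun _ => Set.univ.pi fun _ => E)
    (fun _ _ => MeasurableSet.univ_pi fun _ => hE)
  simp only [Measure.pi_pi, Finset.prod_const, Finset.card_univ, Fintype.card_fin,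
    Finset.card_range] at h
  rw [← h, iidLaw]
  congr 1
  ext x
  simp [Set.mem_pi]

/-- The law of one observation of a sensor after the sensors in `F` have been replaced. -/
def replacedLaw {s : ℕ} (α β : Measure ℝ) (F : Finset (Fin s)) (i : Fin s) : Measure ℝ :=
  if i ∈ F then β else α

instance {s : ℕ} (α β : Measure ℝ) [IsProbabilityMeasure α] [IsProbabilityMeasure β]
    (F : Finset (Fin s)) (i : Fin s) : IsProbabilityMeasure (replacedLaw α β F i) := by
  unfold replacedLaw; split_ifs <;> infer_instance

/-- Each coordinate reads exactly one of the two independent families, so the preimage of a box is a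
product of two boxes. -/
lemma map_replace_infinitePi {s : ℕ} (α β : Measure ℝ) [IsProbabilityMeasure α]
    [IsProbabilityMeasure β] (F : Finset (Fin s)) :
    ((Measure.infinitePi fun _ : ℕ × Fin s => α).prod
      (Measure.infinitePi fun _ : ℕ × Fin s => β)).map
        (fun q p => if p.2 ∈ F then q.2 p else q.1 p) =
      Measure.infinitePi fun p : ℕ × Fin s => replacedLaw α β F p.2 := by
  have hmeas : Measurable (fun (q : (ℕ × Fin s → ℝ) × (ℕ × Fin s → ℝ)) (p : ℕ × Fin s) =>
      if p.2 ∈ F then q.2 p else q.1 p) := by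
    refine measurable_pi_iff.2 fun p => ?_
    by_cases hp : p.2 ∈ F
    · simp only [hp, if_true]; fun_prop
    · simp only [hp, if_false]; fun_prop
  refine Measure.eq_infinitePi _ fun S t ht => ?_
  rw [Measure.map_apply hmeas (MeasurableSet.pi S.countable_toSet fun p _ => ht p)]
  have hpre : (fun (q : (ℕ × Fin s → ℝ) × (ℕ × Fin s → ℝ)) (p : ℕ × Fin s) =>
      if p.2 ∈ F then q.2 p else q.1 p) ⁻¹' (Set.pi S t) =
      (Set.pi (S.filter fun p => p.2 ∉ F : Finset _) t) ×ˢ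
        (Set.pi (S.filter fun p => p.2 ∈ F : Finset _) t) := by
    ext q
    simp only [Set.mem_preimage, Set.mem_pi, Set.mem_prod, Finset.mem_coe, Finset.mem_filter]
    constructor
    · intro h
      refine ⟨fun p hp => ?_, fun p hp => ?_⟩
      · simpa [hp.2] using h p hp.1
      · simpa [hp.2] using h p hp.1
    · intro h p hp
      by_cases hF : p.2 ∈ F
      · simpa [hF] using h.2 p ⟨hp, hF⟩
      · simpa [hF] using h.1 p ⟨hp, hF⟩
  rw [hpre, Measure.prod_prod, Measure.infinitePi_pi _ fun p _ => ht p,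
    Measure.infinitePi_pi _ fun p _ => ht p, mul_comm,
    ← Finset.prod_filter_mul_prod_filter_not S (fun p => p.2 ∈ F)]
  congr 1
  · exact Finset.prod_congr rfl fun p hp => by
      rw [replacedLaw, if_pos (Finset.mem_filter.1 hp).2]
  · exact Finset.prod_congr rfl fun p hp => by
      rw [replacedLaw, if_neg (Finset.mem_filter.1 hp).2]

lemma measurePreserving_replace {s : ℕ} (α β : Measure ℝ) [IsProbabilityMeasure α]
    [IsProbabilityMeasure β] (F : Finset (Fin s)) :
    MeasurePreserving (fun (q : (ℕ → Fin s → ℝ) × (ℕ → Fin s → ℝ)) k i =>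
        if i ∈ F then q.2 k i else q.1 k i)
      ((iidLaw s α).prod (iidLaw s β))
      (Measure.infinitePi fun _ : ℕ => Measure.pi (replacedLaw α β F)) := by
  have hmeas : Measurable (fun (q : (ℕ → Fin s → ℝ) × (ℕ → Fin s → ℝ)) k i =>
      if i ∈ F then q.2 k i else q.1 k i) := by
    refine measurable_pi_iff.2 fun k => measurable_pi_iff.2 fun i => ?_
    by_cases hp : i ∈ F
    · simp only [hp, if_true]; fun_prop
    · simp only [hp, if_false]; fun_prop
  have hmeas' : Measurable (fun (q : (ℕ × Fin s → ℝ) × (ℕ × Fin s → ℝ)) (p : ℕ × Fin s) =>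
      if p.2 ∈ F then q.2 p else q.1 p) := by
    refine measurable_pi_iff.2 fun p => ?_
    by_cases hp : p.2 ∈ F
    · simp only [hp, if_true]; fun_prop
    · simp only [hp, if_false]; fun_prop
  refine ⟨hmeas, ?_⟩
  rw [← map_curry_infinitePi, ← map_replace_infinitePi, iidLaw_eq_map, iidLaw_eq_map,
    Measure.map_prod_map _ _ (by fun_prop) (by fun_prop), Measure.map_map hmeas (by fun_prop),
    Measure.map_map (by fun_prop) hmeas']
  rfl

end Sensors

/-! ### Change of measure for sequential tests. -/

section ChangeOfMeasure

variable {X : Type*} [MeasurableSpace X]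

/-- The law of an i.i.d. sequence. -/
noncomputable def seqLaw (P : Measure X) [IsProbabilityMeasure P] : Measure (ℕ → X) :=
  Measure.infinitePi fun _ : ℕ => P

instance (P : Measure X) [IsProbabilityMeasure P] : IsProbabilityMeasure (seqLaw P) := by
  unfold seqLaw; infer_instance

/-- `Q` has the density `exp (-ℓ)` with respect to `P`. -/
def IsExpTilt (P Q : Measure X) (ℓ : X → ℝ) : Prop :=
  Q = P.withDensity fun x => ENNReal.ofReal (Real.exp (-ℓ x))

/-- The partial sums of a function of the terms of a sequence. -/
def partialSum (ℓ : X → ℝ) (n : ℕ) (x : ℕ → X) : ℝ := ∑ k ∈ Finset.range n, ℓ (x k)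

lemma measurable_past_partialSum {ℓ : X → ℝ} (hℓ : Measurable ℓ) {m n : ℕ} (h : m ≤ n) :
    Measurable[past X n] (partialSum ℓ m) := by
  unfold partialSum
  refine Finset.measurable_sum _ fun k hk => ?_
  exact hℓ.comp (measurable_past_apply ((Finset.mem_range.1 hk).trans_le h))

lemma measurable_partialSum {ℓ : X → ℝ} (hℓ : Measurable ℓ) (n : ℕ) :
    Measurable (partialSum ℓ n) :=
  (measurable_past_partialSum hℓ le_rfl).mono (past_le n) le_rfl

variable {P Q : Measure X} [IsProbabilityMeasure P] [IsProbabilityMeasure Q] {ℓ : X → ℝ}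

lemma integrable_partialSum (hint : Integrable ℓ P) (n : ℕ) :
    Integrable (partialSum ℓ n) (seqLaw P) :=
  integrable_finsetSum _ fun k _ => integrable_comp_apply hint k

lemma seqLaw_past (hℓ : Measurable ℓ) (hQ : IsExpTilt P Q ℓ) {n : ℕ} {S : Set (ℕ → X)}
    (hS : MeasurableSet[past X n] S) :
    seqLaw Q S = ∫⁻ x in S, ENNReal.ofReal (Real.exp (-partialSum ℓ n x)) ∂seqLaw P := by
  unfold IsExpTilt at hQ
  subst hQ
  rw [seqLaw, infinitePi_withDensity_past P (by fun_prop) hS, seqLaw]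
  refine lintegral_congr fun x => ?_
  rw [partialSum, ← Finset.sum_neg_distrib, Real.exp_sum,
    ENNReal.ofReal_prod_of_nonneg fun _ _ => (Real.exp_pos _).le]

/-- Integrate `1 + (t - L) ≤ exp (t - L)` over `S` under `P`, where `L` is the partial sum; the
factor `exp (-L)` turns `P` into `Q` on the past. -/
lemma one_add_mul_measureReal_le (hℓ : Measurable ℓ) (hint : Integrable ℓ P)
    (hQ : IsExpTilt P Q ℓ) {n : ℕ} {S : Set (ℕ → X)} (hS : MeasurableSet[past X n] S) (t : ℝ) :
    (1 + t) * (seqLaw P).real S ≤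
      Real.exp t * (seqLaw Q).real S + ∫ x in S, partialSum ℓ n x ∂seqLaw P := by
  have hS' := past_le n S hS
  have hm : Measurable fun x => Real.exp (-partialSum ℓ n x) :=
    (measurable_partialSum hℓ n).neg.exp
  have h1 := seqLaw_past hℓ hQ hS
  have hfin : Integrable (fun x => Real.exp (-partialSum ℓ n x)) ((seqLaw P).restrict S) := by
    rw [← lintegral_ofReal_ne_top_iff_integrable hm.aestronglyMeasurable
      (ae_of_all _ fun x => (Real.exp_pos _).le), ← h1]
    exact measure_ne_top _ _
  have h2 : (seqLaw Q).real S = ∫ x in S, Real.exp (-partialSum ℓ n x) ∂seqLaw P := by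
    rw [integral_eq_lintegral_of_nonneg_ae (ae_of_all _ fun x => (Real.exp_pos _).le)
      hm.aestronglyMeasurable, ← h1, Measure.real]
  have hL : Integrable (partialSum ℓ n) ((seqLaw P).restrict S) :=
    (integrable_partialSum hint n).restrict
  rw [h2, ← integral_const_mul, ← integral_add (hfin.const_mul _) hL]
  have h3 : (1 + t) * (seqLaw P).real S = ∫ _ in S, (1 + t) ∂seqLaw P := by
    rw [setIntegral_const, smul_eq_mul, mul_comm]
  rw [h3]
  refine integral_mono (integrable_const _) ((hfin.const_mul _).add hL) fun x => ?_
  have h4 := Real.add_one_le_exp (t - partialSum ℓ n x)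
  simp only
  rw [← Real.exp_add, ← sub_eq_add_neg]
  linarith

lemma setIntegral_partialSum_succ (hℓ : Measurable ℓ) (hint : Integrable ℓ P) {n : ℕ}
    {S : Set (ℕ → X)} (hS : MeasurableSet[past X n] S) :
    ∫ x in S, partialSum ℓ (n + 1) x ∂seqLaw P =
      ∫ x in S, partialSum ℓ n x ∂seqLaw P + (seqLaw P).real S * ∫ y, ℓ y ∂P := by
  have h := setIntegral_past_apply P hℓ hS
  have hs : ∀ x, partialSum ℓ (n + 1) x = partialSum ℓ n x + ℓ (x n) := fun x =>
    Finset.sum_range_succ _ _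
  simp only [hs]
  rw [integral_add (integrable_partialSum hint n).restrict
    (integrable_comp_apply hint n).restrict, seqLaw, h]

/-- A sequential test of `P` against `Q`: `N k` is the event that it has not stopped by time `k`,
and `A k` the event that it stops at time `k + 1` and decides for `P`. -/
lemma sum_measureReal_stop_le (hℓ : Measurable ℓ) (hint : Integrable ℓ P) (hQ : IsExpTilt P Q ℓ)
    {N A : ℕ → Set (ℕ → X)} (hN : ∀ k, MeasurableSet[past X k] (N k))
    (hA : ∀ k, MeasurableSet[past X (k + 1)] (A k)) (hAN : ∀ k, A k ⊆ N k)
    (hNN : ∀ k, N (k + 1) ⊆ N k \ A k) (hN0 : N 0 = Set.univ) (t : ℝ) (n : ℕ) :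
    t * ∑ k ∈ Finset.range n, (seqLaw P).real (A k) +
        ((seqLaw Q).real (N n) - (seqLaw P).real (N n) +
          ∫ x in N n, partialSum ℓ n x ∂seqLaw P) ≤
      (Real.exp t - 1) * ∑ k ∈ Finset.range n, (seqLaw Q).real (A k) +
        (∫ y, ℓ y ∂P) * ∑ k ∈ Finset.range n, (seqLaw P).real (N k) := by
  induction n with
  | zero => simp [hN0, partialSum]
  | succ n ih =>
    -- The rest of `N n` after removal of `A n` and `N (n + 1)`: here the test stops at time `n + 1`
    -- without deciding for `P`.
    have hB : MeasurableSet[past X (n + 1)] ((N n \ A n) \ N (n + 1)) :=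
      ((past_mono n.le_succ _ (hN n)).diff (hA n)).diff (hN (n + 1))
    have hd : ∀ R : Measure (ℕ → X), IsProbabilityMeasure R → R.real (N n) =
        R.real (A n) + (R.real (N (n + 1)) + R.real ((N n \ A n) \ N (n + 1))) := by
      intro R _
      rw [← measureReal_sdiff_add_inter (s := N n) (past_le _ _ (hA n)),
        Set.inter_eq_right.2 (hAN n),
        ← measureReal_sdiff_add_inter (s := N n \ A n) (past_le _ _ (hN (n + 1))),
        Set.inter_eq_right.2 (hNN n)]
      ring
    have hi : ∫ x in N n, partialSum ℓ (n + 1) x ∂seqLaw P =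
        ∫ x in A n, partialSum ℓ (n + 1) x ∂seqLaw P +
          (∫ x in N (n + 1), partialSum ℓ (n + 1) x ∂seqLaw P +
            ∫ x in (N n \ A n) \ N (n + 1), partialSum ℓ (n + 1) x ∂seqLaw P) := by
      have hI := integrable_partialSum hint (n + 1)
      rw [← setIntegral_union Set.disjoint_sdiff_right (past_le _ _ hB) hI.integrableOn
        hI.integrableOn, Set.union_sdiff_cancel (hNN n),
        ← setIntegral_union Set.disjoint_sdiff_right
          ((past_le _ _ (hN n)).diff (past_le _ _ (hA n))) hI.integrableOn hI.integrableOn,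
        Set.union_sdiff_cancel (hAN n)]
    have h1 := setIntegral_partialSum_succ hℓ hint (hN n)
    -- The parameter `t` is spent only where the test decides for `P`; on the other stopping event
    -- the case `t = 0` suffices.
    have h2 := one_add_mul_measureReal_le hℓ hint hQ (hA n) t
    have h3 := one_add_mul_measureReal_le hℓ hint hQ hB 0
    have h4 := hd (seqLaw P) inferInstance
    have h5 := hd (seqLaw Q) inferInstance
    rw [Real.exp_zero] at h3
    simp only [Finset.sum_range_succ]
    linarith

/-- The tail sum of the events `N k` is the mean stopping time under `P`. The finite-horizon
inequality passes to the limit because its boundary term is nonnegative, so no integrability of the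
stopped sum is needed. -/
lemma mul_measure_iUnion_le (hℓ : Measurable ℓ) (hint : Integrable ℓ P) (hQ : IsExpTilt P Q ℓ)
    (hJ : 0 ≤ ∫ y, ℓ y ∂P)
    {N A : ℕ → Set (ℕ → X)} (hN : ∀ k, MeasurableSet[past X k] (N k))
    (hA : ∀ k, MeasurableSet[past X (k + 1)] (A k)) (hAN : ∀ k, A k ⊆ N k)
    (hNN : ∀ k, N (k + 1) ⊆ N k \ A k) (hN0 : N 0 = Set.univ) {t : ℝ} (ht : 0 ≤ t) :
    ENNReal.ofReal t * seqLaw P (⋃ k, A k) ≤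
      ENNReal.ofReal (Real.exp t) * seqLaw Q (⋃ k, A k) +
        ENNReal.ofReal (∫ y, ℓ y ∂P) * ∑' k, seqLaw P (N k) := by
  have hanti : Antitone N := antitone_nat_of_succ_le fun k => (hNN k).trans Set.sdiff_subset
  have hlt : ∀ i j, i < j → Disjoint (A i) (A j) := fun i j h =>
    Set.disjoint_left.2 fun x hi hj => (hNN i (hanti h (hAN j hj))).2 hi
  have hdisj : Pairwise (Function.onFun Disjoint A) := fun i j h => by
    rcases lt_or_gt_of_ne h with h | h
    · exact hlt i j h
    · exact (hlt j i h).symm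
  have hAm : ∀ k, MeasurableSet (A k) := fun k => past_le _ _ (hA k)
  rw [measure_iUnion hdisj hAm, measure_iUnion hdisj hAm, ← ENNReal.tsum_mul_left]
  refine ENNReal.tsum_le_of_sum_range_le fun n => ?_
  rw [← Finset.mul_sum]
  have h := sum_measureReal_stop_le hℓ hint hQ hN hA hAN hNN hN0 t n
  -- The case `t = 0` on `N n` says exactly that the boundary term left over at time `n` is
  -- nonnegative.
  have h0 := one_add_mul_measureReal_le hℓ hint hQ (hN n) 0
  rw [Real.exp_zero] at h0
  have hQ0 : 0 ≤ ∑ k ∈ Finset.range n, (seqLaw Q).real (A k) :=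
    Finset.sum_nonneg fun _ _ => measureReal_nonneg
  have key : t * ∑ k ∈ Finset.range n, (seqLaw P).real (A k) ≤
      Real.exp t * ∑ k ∈ Finset.range n, (seqLaw Q).real (A k) +
        (∫ y, ℓ y ∂P) * ∑ k ∈ Finset.range n, (seqLaw P).real (N k) := by linarith
  have hs : ∀ (R : Measure (ℕ → X)) (_ : IsProbabilityMeasure R) (S : ℕ → Set (ℕ → X)),
      ∑ k ∈ Finset.range n, R (S k) =
        ENNReal.ofReal (∑ k ∈ Finset.range n, R.real (S k)) := by
    intro R _ S
    rw [ENNReal.ofReal_sum_of_nonneg fun _ _ => measureReal_nonneg]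
    exact Finset.sum_congr rfl fun k _ => (ofReal_measureReal).symm
  calc ENNReal.ofReal t * ∑ k ∈ Finset.range n, seqLaw P (A k)
      ≤ ENNReal.ofReal (Real.exp t) * ∑ k ∈ Finset.range n, seqLaw Q (A k) +
        ENNReal.ofReal (∫ y, ℓ y ∂P) * ∑ k ∈ Finset.range n, seqLaw P (N k) := by
        rw [hs _ inferInstance, hs _ inferInstance, hs _ inferInstance,
          ← ENNReal.ofReal_mul ht, ← ENNReal.ofReal_mul (Real.exp_pos t).le,
          ← ENNReal.ofReal_mul hJ, ← ENNReal.ofReal_add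
            (mul_nonneg (Real.exp_pos t).le hQ0)
            (mul_nonneg hJ (Finset.sum_nonneg fun _ _ => measureReal_nonneg))]
        exact ENNReal.ofReal_le_ofReal key
    _ ≤ _ := by
        gcongr
        · exact ENNReal.sum_le_tsum _
        · exact ENNReal.sum_le_tsum _

/-- Ville's inequality for the likelihood ratio of two i.i.d. sequences. -/
lemma seqLaw_exists_le_partialSum (hℓ : Measurable ℓ) (hQ : IsExpTilt P Q ℓ) (b : ℝ) :
    seqLaw Q {x | ∃ k, b ≤ partialSum ℓ (k + 1) x} ≤ ENNReal.ofReal (Real.exp (-b)) := by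
  have hE : ∀ k, MeasurableSet[past X (k + 1)] {x : ℕ → X | b ≤ partialSum ℓ (k + 1) x} :=
    fun k => measurable_past_partialSum hℓ le_rfl measurableSet_Ici
  -- Split according to the first time at which the level `b` is reached: each piece belongs to the
  -- past at that time, and on it the density is at most `exp (-b)`.
  have hD : ∀ k, MeasurableSet[past X (k + 1)]
      (disjointed (fun k => {x : ℕ → X | b ≤ partialSum ℓ (k + 1) x}) k) := by
    intro k
    rw [disjointed_apply]
    refine (hE k).diff ?_
    rw [Finset.sup_set_eq_biUnion]
    exact Finset.measurableSet_biUnion _ fun j hj =>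
      past_mono (by have := Finset.mem_Iio.1 hj; omega) _ (hE j)
  have hU : {x : ℕ → X | ∃ k, b ≤ partialSum ℓ (k + 1) x} =
      ⋃ k, disjointed (fun k => {x : ℕ → X | b ≤ partialSum ℓ (k + 1) x}) k := by
    rw [iUnion_disjointed]; ext x; simp
  have hdm := fun k => past_le _ _ (hD k)
  rw [hU, measure_iUnion (disjoint_disjointed _) hdm]
  calc ∑' k, seqLaw Q (disjointed (fun k => {x : ℕ → X | b ≤ partialSum ℓ (k + 1) x}) k)
      ≤ ∑' k, ENNReal.ofReal (Real.exp (-b)) *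
          seqLaw P (disjointed (fun k => {x : ℕ → X | b ≤ partialSum ℓ (k + 1) x}) k) := by
        refine ENNReal.tsum_le_tsum fun k => ?_
        rw [seqLaw_past hℓ hQ (hD k), ← setLIntegral_const]
        refine setLIntegral_mono measurable_const fun x hx => ?_
        have : b ≤ partialSum ℓ (k + 1) x := disjointed_subset _ k hx
        gcongr
    _ = ENNReal.ofReal (Real.exp (-b)) *
          seqLaw P (⋃ k, disjointed (fun k => {x : ℕ → X | b ≤ partialSum ℓ (k + 1) x}) k) := by
        rw [measure_iUnion (disjoint_disjointed _) hdm, ENNReal.tsum_mul_left]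
    _ ≤ _ := by
        refine mul_le_of_le_one_right' ?_
        exact prob_le_one

end ChangeOfMeasure

/-! ### The log-likelihood ratio oriented towards the true state. -/

section StateLLR

variable {μ ν : Measure ℝ}

/-- The log-likelihood ratio of the state `θ` against the other one. -/
noncomputable def stateLLR (μ ν : Measure ℝ) : Bool → ℝ → ℝ
  | false => fun x => -llr μ ν x
  | true => llr μ ν

@[fun_prop]
lemma measurable_stateLLR (θ : Bool) : Measurable (stateLLR μ ν θ) := by
  cases θ
  · exact (measurable_llr μ ν).neg
  · exact measurable_llr μ ν

lemma integrable_stateLLR (hμ : Integrable (llr μ ν) μ) (hν : Integrable (llr μ ν) ν)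
    (θ : Bool) : Integrable (stateLLR μ ν θ) (stateLaw μ ν θ) := by
  cases θ
  · exact hν.neg
  · exact hμ

lemma integral_stateLLR_true : ∫ x, stateLLR μ ν true x ∂stateLaw μ ν true = klOne μ ν := rfl

lemma integral_stateLLR_false :
    ∫ x, stateLLR μ ν false x ∂stateLaw μ ν false = klZero μ ν :=
  integral_neg _

lemma min_kl_le_integral_stateLLR (θ : Bool) :
    min (klZero μ ν) (klOne μ ν) ≤ ∫ x, stateLLR μ ν θ x ∂stateLaw μ ν θ := by
  cases θ
  · rw [integral_stateLLR_false]; exact min_le_left _ _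
  · rw [integral_stateLLR_true]; exact min_le_right _ _

lemma withDensity_eq_of_ae {α β : Measure ℝ} [IsProbabilityMeasure α] [IsProbabilityMeasure β]
    (h : β ≪ α) {e : ℝ → ℝ} (he : e =ᵐ[α] fun x => (β.rnDeriv α x).toReal) :
    β = α.withDensity fun x => ENNReal.ofReal (e x) := by
  conv_lhs => rw [← Measure.withDensity_rnDeriv_eq β α h]
  refine withDensity_congr_ae ?_
  filter_upwards [he, β.rnDeriv_lt_top α] with x hx hx'
  rw [hx, ENNReal.ofReal_toReal hx'.ne]

lemma isExpTilt_stateLLR [IsProbabilityMeasure μ] [IsProbabilityMeasure ν]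
    (hμν : μ ≪ ν) (hνμ : ν ≪ μ) (θ : Bool) :
    IsExpTilt (stateLaw μ ν θ) (stateLaw μ ν (!θ)) (stateLLR μ ν θ) := by
  cases θ
  · refine withDensity_eq_of_ae (α := ν) (β := μ) hμν ?_
    simp only [stateLLR, neg_neg]
    -- As `log 0 = 0`, the exponential is wrong where `dμ/dν` vanishes; `ν ≪ μ` makes this set
    -- `ν`-null.
    exact exp_llr_of_ac' μ ν hνμ
  · exact withDensity_eq_of_ae (α := μ) (β := ν) hνμ (exp_neg_llr hμν)

end StateLLR

/-! ### Stopping times and error probabilities of an arbitrary detector. -/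

section Detectors

variable {s : ℕ}

/-- The layer-cake form of `T`, with one term for each `k ≥ 0` such that `T > k`. The index `j < k`
stands for the time `j + 1 ≤ k`. -/
lemma stopTime_eq_tsum (f : Detector s) (u : f.Aux) (y : ℕ → Fin s → ℝ) :
    (f.stopTime u y : ℝ≥0∞) =
      ∑' k, {k : ℕ | ∀ j < k, f.at u y j = none}.indicator (fun _ => (1 : ℝ≥0∞)) k := by
  classical
  by_cases h : ∃ k, f.at u y k ≠ none
  · have h1 : f.stopTime u y = ((Nat.find h + 1 : ℕ) : ℕ∞) := by
      refine le_antisymm (iInf₂_le (Nat.find h) (Nat.find_spec h)) (le_iInf₂ fun k hk => ?_)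
      exact_mod_cast Nat.succ_le_succ (Nat.find_min' h hk)
    have h2 : {k : ℕ | ∀ j < k, f.at u y j = none} = (Finset.range (Nat.find h + 1) : Set ℕ) := by
      ext k
      simp only [Set.mem_ofPred_eq, Finset.coe_range, Set.mem_Iio, Nat.lt_succ_iff]
      constructor
      · intro hk
        by_contra hlt
        exact Nat.find_spec h (hk _ (not_le.1 hlt))
      · intro hk j hj
        exact not_not.1 (Nat.find_min h (hj.trans_le hk))
    rw [h1, h2, ← tsum_subtype, Finset.tsum_subtype' (f := fun _ => (1 : ℝ≥0∞))]
    simp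
  · push Not at h
    have h1 : f.stopTime u y = ⊤ := by simp [Detector.stopTime, h]
    have h2 : {k : ℕ | ∀ j < k, f.at u y j = none} = Set.univ := by ext k; simp [h]
    rw [h1, h2, Set.indicator_univ, ENNReal.tsum_const_eq_top_of_ne_zero one_ne_zero]
    rfl

lemma measurableSet_at (f : Detector s) (k : ℕ) (o : Option Bool) :
    MeasurableSet {p : (ℕ → Fin s → ℝ) × f.Aux | f.at p.2 p.1 k = o} := by
  have h : Measurable fun p : (ℕ → Fin s → ℝ) × f.Aux => (initial (k + 1) p.1, p.2) :=
    ((measurable_initial _).comp measurable_fst).prodMk measurable_snd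
  exact h (f.measurable_rule k o)

lemma measurableSet_past_at (f : Detector s) (u : f.Aux) (k : ℕ) (o : Option Bool) :
    MeasurableSet[past (Fin s → ℝ) (k + 1)] {y : ℕ → Fin s → ℝ | f.at u y k = o} :=
  ⟨(fun z => (z, u)) ⁻¹' {p | f.rule k p.1 p.2 = o},
    (f.measurable_rule k o).preimage (by fun_prop), rfl⟩

lemma measurableSet_continue (f : Detector s) (k : ℕ) :
    MeasurableSet {p : (ℕ → Fin s → ℝ) × f.Aux | ∀ j < k, f.at p.2 p.1 j = none} := by
  simp only [Set.ofPred_forall]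
  exact MeasurableSet.iInter fun j => MeasurableSet.iInter fun _ => measurableSet_at f j none

lemma measurableSet_accepts (f : Detector s) (d : Bool) :
    MeasurableSet {p : (ℕ → Fin s → ℝ) × f.Aux | f.Accepts p.2 p.1 d} := by
  simp only [Detector.Accepts, Set.ofPred_exists]
  exact MeasurableSet.iUnion fun k => (measurableSet_at f k _).inter (measurableSet_continue f k)

lemma stopTime_eq_tsum_indicator (f : Detector s) (p : (ℕ → Fin s → ℝ) × f.Aux) :
    (f.stopTime p.2 p.1 : ℝ≥0∞) = ∑' k, {p : (ℕ → Fin s → ℝ) × f.Aux |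
      ∀ j < k, f.at p.2 p.1 j = none}.indicator (fun _ => (1 : ℝ≥0∞)) p := by
  rw [stopTime_eq_tsum]
  rfl

lemma measurable_stopTime (f : Detector s) :
    Measurable fun p : (ℕ → Fin s → ℝ) × f.Aux => (f.stopTime p.2 p.1 : ℝ≥0∞) := by
  simp only [stopTime_eq_tsum_indicator]
  exact Measurable.tsum fun k => measurable_const.indicator (measurableSet_continue f k)

variable {P Q : Measure (Fin s → ℝ)} [IsProbabilityMeasure P] [IsProbabilityMeasure Q]
  {ℓ : (Fin s → ℝ) → ℝ}

/-- With the private randomness frozen, the decisions depend only on the past of the received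
sequence, so the inequality for sequential tests applies. -/
lemma mul_measure_accepts_le_of_fixed (hℓ : Measurable ℓ) (hint : Integrable ℓ P)
    (hQ : IsExpTilt P Q ℓ) (hJ : 0 ≤ ∫ y, ℓ y ∂P) (f : Detector s) (u : f.Aux) (d : Bool)
    {t : ℝ} (ht : 0 ≤ t) :
    ENNReal.ofReal t * seqLaw P {y | f.Accepts u y d} ≤
      ENNReal.ofReal (Real.exp t) * seqLaw Q {y | f.Accepts u y d} +
        ENNReal.ofReal (∫ y, ℓ y ∂P) * ∫⁻ y, (f.stopTime u y : ℝ≥0∞) ∂seqLaw P := by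
  have hN : ∀ k, MeasurableSet[past (Fin s → ℝ) k]
      {y : ℕ → Fin s → ℝ | ∀ j < k, f.at u y j = none} := by
    intro k
    simp only [Set.ofPred_forall]
    exact MeasurableSet.iInter fun j => MeasurableSet.iInter fun hj =>
      past_mono hj _ (measurableSet_past_at f u j none)
  have hA : ∀ k, MeasurableSet[past (Fin s → ℝ) (k + 1)]
      {y : ℕ → Fin s → ℝ | f.at u y k = some d ∧ ∀ j < k, f.at u y j = none} := fun k =>
    (measurableSet_past_at f u k _).inter (past_mono k.le_succ _ (hN k))
  have h := mul_measure_iUnion_le hℓ hint hQ hJ hN hA (fun k y hy => hy.2)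
    (fun k y hy => ⟨fun j hj => hy j (hj.trans k.lt_succ_self),
      fun hy' => by simpa [hy k k.lt_succ_self] using hy'.1⟩) (by ext; simp) ht
  have hU : {y | f.Accepts u y d} =
      ⋃ k, {y : ℕ → Fin s → ℝ | f.at u y k = some d ∧ ∀ j < k, f.at u y j = none} := by
    ext y; simp [Detector.Accepts]
  have hT : ∫⁻ y, (f.stopTime u y : ℝ≥0∞) ∂seqLaw P =
      ∑' k, seqLaw P {y : ℕ → Fin s → ℝ | ∀ j < k, f.at u y j = none} := by
    have h1 : ∀ y, (f.stopTime u y : ℝ≥0∞) =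
        ∑' k, {y : ℕ → Fin s → ℝ | ∀ j < k, f.at u y j = none}.indicator
          (fun _ => (1 : ℝ≥0∞)) y := fun y => by rw [stopTime_eq_tsum]; rfl
    simp only [h1]
    rw [lintegral_tsum fun k =>
      (measurable_const.indicator (past_le _ _ (hN k))).aemeasurable]
    exact tsum_congr fun k => by rw [lintegral_indicator_const (past_le _ _ (hN k)), one_mul]
  rw [hU, hT]
  exact h

lemma mul_measure_accepts_le (hℓ : Measurable ℓ) (hint : Integrable ℓ P)
    (hQ : IsExpTilt P Q ℓ) (hJ : 0 ≤ ∫ y, ℓ y ∂P) (f : Detector s) (d : Bool)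
    {t : ℝ} (ht : 0 ≤ t) :
    ENNReal.ofReal t * (seqLaw P).prod f.auxLaw {p | f.Accepts p.2 p.1 d} ≤
      ENNReal.ofReal (Real.exp t) * (seqLaw Q).prod f.auxLaw {p | f.Accepts p.2 p.1 d} +
        ENNReal.ofReal (∫ y, ℓ y ∂P) *
          ∫⁻ p, (f.stopTime p.2 p.1 : ℝ≥0∞) ∂(seqLaw P).prod f.auxLaw := by
  have hm := measurableSet_accepts f d
  have hT := measurable_stopTime f
  have hR : ∀ (R : Measure (ℕ → Fin s → ℝ)) [IsProbabilityMeasure R],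
      Measurable fun u => R {y | f.Accepts u y d} := fun R _ =>
    measurable_measure_prodMk_right hm
  have hm1 : Measurable fun u => ∫⁻ y, (f.stopTime u y : ℝ≥0∞) ∂seqLaw P :=
    Measurable.lintegral_prod_left' hT
  rw [Measure.prod_apply_symm hm, Measure.prod_apply_symm hm,
    lintegral_prod_symm _ hT.aemeasurable]
  change ENNReal.ofReal t * ∫⁻ u, seqLaw P {y | f.Accepts u y d} ∂f.auxLaw ≤
    ENNReal.ofReal (Real.exp t) * ∫⁻ u, seqLaw Q {y | f.Accepts u y d} ∂f.auxLaw +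
      ENNReal.ofReal (∫ y, ℓ y ∂P) *
        ∫⁻ u, ∫⁻ y, (f.stopTime u y : ℝ≥0∞) ∂seqLaw P ∂f.auxLaw
  rw [← lintegral_const_mul _ (hR _), ← lintegral_const_mul _ (hR _),
    ← lintegral_const_mul _ hm1, ← lintegral_add_left ((hR _).const_mul _)]
  exact lintegral_mono fun u => mul_measure_accepts_le_of_fixed hℓ hint hQ hJ f u d ht

/-- A finite mean makes `T` finite almost surely, and then exactly one hypothesis is accepted. -/
lemma measure_accepts_add_eq_one (f : Detector s) {ρ : Measure ((ℕ → Fin s → ℝ) × f.Aux)}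
    [IsProbabilityMeasure ρ] (hT : ∫⁻ p, (f.stopTime p.2 p.1 : ℝ≥0∞) ∂ρ ≠ ⊤) (d : Bool) :
    ρ.real {p | f.Accepts p.2 p.1 d} + ρ.real {p | f.Accepts p.2 p.1 (!d)} = 1 := by
  classical
  have hdisj : Disjoint {p : (ℕ → Fin s → ℝ) × f.Aux | f.Accepts p.2 p.1 d}
      {p | f.Accepts p.2 p.1 (!d)} := by
    refine Set.disjoint_left.2 fun p hp hp' => ?_
    obtain ⟨k, hk, hk'⟩ := hp
    obtain ⟨l, hl, hl'⟩ := hp'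
    rcases lt_trichotomy k l with h | h | h
    · simp [hl' k h] at hk
    · subst h; simp [hk] at hl
    · simp [hk' l h] at hl
  rw [← measureReal_union hdisj (measurableSet_accepts f _), measureReal_def]
  have hae : ∀ᵐ p ∂ρ, p ∈ {p : (ℕ → Fin s → ℝ) × f.Aux | f.Accepts p.2 p.1 d} ∪
      {p | f.Accepts p.2 p.1 (!d)} := by
    filter_upwards [ae_lt_top (measurable_stopTime f) hT] with p hp
    have hex : ∃ k, f.at p.2 p.1 k ≠ none := by
      by_contra h
      push Not at h
      have h1 : f.stopTime p.2 p.1 = ⊤ := by simp [Detector.stopTime, h]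
      rw [h1] at hp
      exact absurd hp (by simp)
    obtain ⟨b, hb⟩ := Option.ne_none_iff_exists'.1 (Nat.find_spec hex)
    have hacc : f.Accepts p.2 p.1 b :=
      ⟨Nat.find hex, hb, fun j hj => not_not.1 (Nat.find_min hex hj)⟩
    by_cases hbd : b = d
    · left; subst hbd; exact hacc
    · right
      have : b = !d := by cases b <;> cases d <;> simp_all
      subst this; exact hacc
  have h1 := prob_compl_eq_zero_iff
    ((measurableSet_accepts f d).union (measurableSet_accepts f (!d))) (μ := ρ)
  rw [h1.1 (mem_ae_iff.1 hae)]
  rfl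

end Detectors

/-! ### The flip attack and the upper bound for every detector. -/

section Flip

variable {μ ν : Measure ℝ} [IsProbabilityMeasure μ] [IsProbabilityMeasure ν] {s c : ℕ}

/-- The law of the vector received at one time under the flip attack. -/
noncomputable def flipLaw (μ ν : Measure ℝ) (s c : ℕ) (θ : Bool) : Measure (Fin s → ℝ) :=
  Measure.pi (replacedLaw (stateLaw μ ν θ) (stateLaw μ ν (!θ)) (flipped s c θ))

instance (θ : Bool) : IsProbabilityMeasure (flipLaw μ ν s c θ) := by
  unfold flipLaw; infer_instance

/-- The sensors that are honest in both states under the flip attack. -/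
def neverFlipped (s c : ℕ) : Finset (Fin s) :=
  Finset.univ.filter fun i => c ≤ (i : ℕ) ∧ (i : ℕ) < s - c

lemma card_neverFlipped (h : 2 * c < s) : (neverFlipped s c).card = s - 2 * c := by
  have h1 := Finset.card_filter_add_card_filter_not
    (s := (Finset.univ : Finset (Fin s)).filter fun i : Fin s => (i : ℕ) < s - c)
    (fun i : Fin s => (i : ℕ) < c)
  rw [Finset.filter_filter, Finset.filter_filter, Fin.card_filter_val_lt] at h1
  have h2 : ((Finset.univ : Finset (Fin s)).filter fun i : Fin s => (i : ℕ) < s - c ∧ (i : ℕ) < c) =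
      Finset.univ.filter fun i : Fin s => (i : ℕ) < c :=
    Finset.filter_congr fun i _ => by omega
  have h3 : ((Finset.univ : Finset (Fin s)).filter fun i : Fin s => (i : ℕ) < s - c ∧ ¬ (i : ℕ) < c) =
      neverFlipped s c :=
    Finset.filter_congr fun i _ => by omega
  rw [h2, h3, Fin.card_filter_val_lt] at h1
  omega

/-- Such a sensor has its law flipped in one state and not in the other, hence the same law in both:
it tells the detector nothing. -/
lemma mem_flipped_not_iff (h : 2 * c < s) {i : Fin s} (hi : i ∉ neverFlipped s c) (θ : Bool) :
    i ∈ flipped s c (!θ) ↔ i ∉ flipped s c θ := by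
  have hi' : ¬ (c ≤ (i : ℕ) ∧ (i : ℕ) < s - c) := by simpa [neverFlipped] using hi
  cases θ <;> simp only [flipped, Bool.not_true, Bool.not_false, Finset.mem_filter,
    Finset.mem_univ, true_and] <;> omega

lemma notMem_flipped {i : Fin s} (hi : i ∈ neverFlipped s c) (θ : Bool) :
    i ∉ flipped s c θ := by
  have hi' : c ≤ (i : ℕ) ∧ (i : ℕ) < s - c := by simpa [neverFlipped] using hi
  cases θ <;> simp only [flipped, Finset.mem_filter, Finset.mem_univ, true_and] <;> omega

/-- The log-likelihood ratio of the state `θ` against the other one, for the vector received at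
one time under the flip attack. -/
noncomputable def flipLLR (μ ν : Measure ℝ) (s c : ℕ) (θ : Bool) (x : Fin s → ℝ) : ℝ :=
  ∑ i ∈ neverFlipped s c, stateLLR μ ν θ (x i)

lemma measurable_flipLLR {μ ν : Measure ℝ} {s c : ℕ} (θ : Bool) : Measurable (flipLLR μ ν s c θ) := by
  unfold flipLLR
  exact Finset.measurable_sum _ fun i _ => (measurable_stateLLR θ).comp (measurable_pi_apply i)

lemma measurePreserving_flipLaw_eval {i : Fin s} (hi : i ∈ neverFlipped s c) (θ : Bool) :
    MeasurePreserving (fun x : Fin s → ℝ => x i) (flipLaw μ ν s c θ) (stateLaw μ ν θ) := by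
  have h := measurePreserving_eval
    (replacedLaw (stateLaw μ ν θ) (stateLaw μ ν (!θ)) (flipped s c θ)) i
  have h2 : replacedLaw (stateLaw μ ν θ) (stateLaw μ ν (!θ)) (flipped s c θ) i =
      stateLaw μ ν θ := if_neg (notMem_flipped hi θ)
  rw [h2] at h
  exact h

lemma integrable_flipLLR (hμ : Integrable (llr μ ν) μ) (hν : Integrable (llr μ ν) ν) (θ : Bool) :
    Integrable (flipLLR μ ν s c θ) (flipLaw μ ν s c θ) :=
  integrable_finsetSum _ fun _ hi =>
    (measurePreserving_flipLaw_eval hi θ).integrable_comp_of_integrable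
      (integrable_stateLLR hμ hν θ)

lemma integral_flipLLR (hμ : Integrable (llr μ ν) μ) (hν : Integrable (llr μ ν) ν)
    (h : 2 * c < s) (θ : Bool) :
    ∫ x, flipLLR μ ν s c θ x ∂flipLaw μ ν s c θ =
      ((s : ℝ) - 2 * c) * ∫ x, stateLLR μ ν θ x ∂stateLaw μ ν θ := by
  have h1 : ∀ i ∈ neverFlipped s c,
      ∫ x : Fin s → ℝ, stateLLR μ ν θ (x i) ∂flipLaw μ ν s c θ =
        ∫ x, stateLLR μ ν θ x ∂stateLaw μ ν θ := fun i hi =>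
    (measurePreserving_flipLaw_eval hi θ).hasLaw.integral_comp
      (measurable_stateLLR θ).aestronglyMeasurable
  unfold flipLLR
  rw [integral_finsetSum (neverFlipped s c) (f := fun i (x : Fin s → ℝ) => stateLLR μ ν θ (x i))
    fun i hi => (measurePreserving_flipLaw_eval hi θ).integrable_comp_of_integrable
      (integrable_stateLLR hμ hν θ), Finset.sum_congr rfl h1, Finset.sum_const,
    card_neverFlipped h, nsmul_eq_mul, Nat.cast_sub h.le]
  push_cast
  rfl

/-- The uninformative sensors contribute the density factor `1`, and each never flipped sensor
contributes its own likelihood ratio. -/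
lemma isExpTilt_flipLLR (hμν : μ ≪ ν) (hνμ : ν ≪ μ) (h : 2 * c < s) (θ : Bool) :
    IsExpTilt (flipLaw μ ν s c θ) (flipLaw μ ν s c (!θ)) (flipLLR μ ν s c θ) := by
  set ρ := replacedLaw (stateLaw μ ν θ) (stateLaw μ ν (!θ)) (flipped s c θ) with hρ
  set f : Fin s → ℝ → ℝ≥0∞ := fun i x =>
    if i ∈ neverFlipped s c then ENNReal.ofReal (Real.exp (-stateLLR μ ν θ x)) else 1 with hf
  have hfm : ∀ i, Measurable (f i) := by
    intro i
    by_cases hi : i ∈ neverFlipped s c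
    · simp only [hf, hi, if_true]
      fun_prop
    · simp only [hf, hi, if_false]
      fun_prop
  have hd : ∀ i, (ρ i).withDensity (f i) =
      replacedLaw (stateLaw μ ν (!θ)) (stateLaw μ ν (!!θ)) (flipped s c (!θ)) i := by
    intro i
    by_cases hi : i ∈ neverFlipped s c
    · have h1 : f i = fun x => ENNReal.ofReal (Real.exp (-stateLLR μ ν θ x)) := by
        ext x; simp [hf, hi]
      rw [hρ, replacedLaw, replacedLaw, if_neg (notMem_flipped hi _),
        if_neg (notMem_flipped hi _), h1]
      exact (isExpTilt_stateLLR hμν hνμ θ).symm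
    · have h1 : f i = 1 := by ext x; simp [hf, hi]
      rw [h1, withDensity_one, hρ, replacedLaw, replacedLaw, Bool.not_not]
      have h2 := mem_flipped_not_iff h hi θ
      by_cases h3 : i ∈ flipped s c θ
      · rw [if_pos h3, if_neg (fun h4 => h2.1 h4 h3)]
      · rw [if_neg h3, if_pos (h2.2 h3)]
  have hprob : ∀ i, IsProbabilityMeasure ((ρ i).withDensity (f i)) := fun i => by
    rw [hd i]; infer_instance
  have hpi := pi_withDensity ρ hfm
  simp only [hd] at hpi
  rw [IsExpTilt, flipLaw, hpi, flipLaw]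
  congr 1
  ext x
  rw [flipLLR, ← Finset.sum_neg_distrib, Real.exp_sum,
    ENNReal.ofReal_prod_of_nonneg fun _ _ => (Real.exp_pos _).le]
  simp only [hf]
  rw [Finset.prod_ite_mem, Finset.univ_inter]

lemma biasSeq_eq (g : Attack s c) (θ : Bool) (v : g.Aux) (x : ℕ → Fin s → ℝ) (k : ℕ) :
    biasSeq g θ v x k =
      g.bias θ k v (fun j i => x j i) (fun j : Fin k => biasSeq g θ v x j) := by
  rw [biasSeq]

lemma received_flipAttack (h : 2 * c < s) (θ : Bool) (v x : ℕ → Fin s → ℝ) :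
    received (flipAttack μ ν h) θ v x =
      fun k i => if i ∈ flipped s c θ then v k i else x k i := by
  ext k i
  have hb : biasSeq (flipAttack μ ν h) θ v x k i =
      if i ∈ flipped s c θ then v k i - x k i else 0 := by
    refine (congrFun (biasSeq_eq (flipAttack μ ν h) θ v x k) i).trans ?_
    simp [flipAttack]
  change x k i + biasSeq (flipAttack μ ν h) θ v x k i = _
  rw [hb]
  split_ifs <;> ring

/-- This reduces the game against the flip attack to an ordinary sequential test between two i.i.d.
laws. -/
lemma measurePreserving_flipAttack (h : 2 * c < s) (f : Detector s) (θ : Bool) :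
    MeasurePreserving
      (fun ω : (ℕ → Fin s → ℝ) × (flipAttack μ ν h).Aux × f.Aux =>
        (received (flipAttack μ ν h) θ ω.2.1 ω.1, ω.2.2))
      (jointLaw μ ν f (flipAttack μ ν h) θ)
      ((seqLaw (flipLaw μ ν s c θ)).prod f.auxLaw) := by
  have h1 := (measurePreserving_replace (stateLaw μ ν θ) (stateLaw μ ν (!θ))
    (flipped s c θ)).prod (MeasurePreserving.id f.auxLaw)
  have h2 := (measurePreserving_prodAssoc (iidLaw s (stateLaw μ ν θ))
    (iidLaw s (stateLaw μ ν (!θ))) f.auxLaw).symm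
  have h3 := h1.comp h2
  have heq : (fun ω : (ℕ → Fin s → ℝ) × (flipAttack μ ν h).Aux × f.Aux =>
      (received (flipAttack μ ν h) θ ω.2.1 ω.1, ω.2.2)) =
      fun ω : (ℕ → Fin s → ℝ) × (ℕ → Fin s → ℝ) × f.Aux =>
        ((fun k i => if i ∈ flipped s c θ then ω.2.1 k i else ω.1 k i), ω.2.2) :=
    funext fun ω => Prod.ext (received_flipAttack h θ _ _) rfl
  rw [heq]
  exact h3

lemma acceptProb_flipAttack (h : 2 * c < s) (f : Detector s) (θ d : Bool) :
    acceptProb μ ν f (flipAttack μ ν h) θ d =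
      ((seqLaw (flipLaw μ ν s c θ)).prod f.auxLaw).real {p | f.Accepts p.2 p.1 d} :=
  (measurePreserving_flipAttack h f θ).measureReal_preimage
    (measurableSet_accepts f d).nullMeasurableSet

lemma meanTime_flipAttack (h : 2 * c < s) (f : Detector s) (θ : Bool) :
    meanTime μ ν f (flipAttack μ ν h) θ =
      ∫⁻ p, (f.stopTime p.2 p.1 : ℝ≥0∞) ∂(seqLaw (flipLaw μ ν s c θ)).prod f.auxLaw :=
  (measurePreserving_flipAttack h f θ).lintegral_comp (measurable_stopTime f)

/-- In the inequality for tests take `t = log (1/e)`: the wrong acceptance of `θ` has probability at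
most `e`, so its term is at most `exp t * e = 1`, while the correct acceptance has probability at
least `1 - e`. -/
lemma log_mul_one_sub_acceptProb_le (hμν : μ ≪ ν) (hνμ : ν ≪ μ) (hμ : Integrable (llr μ ν) μ)
    (hν : Integrable (llr μ ν) ν) (h : 2 * c < s) (θ : Bool)
    (hI : 0 ≤ ∫ x, stateLLR μ ν θ x ∂stateLaw μ ν θ) (f : Detector s) {e : ℝ} (he0 : 0 < e)
    (he1 : e ≤ 1) (hα : acceptProb μ ν f (flipAttack μ ν h) (!θ) θ ≤ e)
    (hβ : acceptProb μ ν f (flipAttack μ ν h) θ (!θ) ≤ e)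
    (hT : meanTime μ ν f (flipAttack μ ν h) θ ≠ ⊤) :
    (1 - e) * Real.log (1 / e) - 1 ≤
      ((s : ℝ) - 2 * c) * (∫ x, stateLLR μ ν θ x ∂stateLaw μ ν θ) *
        (meanTime μ ν f (flipAttack μ ν h) θ).toReal := by
  have hsc : (0 : ℝ) ≤ (s : ℝ) - 2 * c := by
    have : (2 * c : ℝ) ≤ s := by exact_mod_cast h.le
    linarith
  set t := Real.log (1 / e) with ht
  have ht0 : 0 ≤ t := Real.log_nonneg (by rw [le_div_iff₀ he0]; linarith)
  have hexp : Real.exp t = 1 / e := Real.exp_log (by positivity)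
  have hJ := integral_flipLLR hμ hν h θ
  have hJ0 : 0 ≤ ∫ x, flipLLR μ ν s c θ x ∂flipLaw μ ν s c θ := by
    rw [hJ]; exact mul_nonneg hsc hI
  have h1 := mul_measure_accepts_le (measurable_flipLLR θ) (integrable_flipLLR hμ hν θ)
    (isExpTilt_flipLLR hμν hνμ h θ) hJ0 f θ ht0
  rw [meanTime_flipAttack] at hT ⊢
  rw [acceptProb_flipAttack] at hα hβ
  have h2 := ENNReal.toReal_mono (by finiteness) h1
  rw [ENNReal.toReal_add (by finiteness) (by finiteness), ENNReal.toReal_mul, ENNReal.toReal_mul,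
    ENNReal.toReal_mul, ENNReal.toReal_ofReal ht0, ENNReal.toReal_ofReal (Real.exp_pos _).le,
    ENNReal.toReal_ofReal hJ0, hexp, hJ] at h2
  simp only [← measureReal_def] at h2
  have h3 := measure_accepts_add_eq_one f hT θ
  have h4 : 1 / e * ((seqLaw (flipLaw μ ν s c (!θ))).prod f.auxLaw).real
      {p | f.Accepts p.2 p.1 θ} ≤ 1 := by
    rw [one_div_mul_eq_div, div_le_one he0]; exact hα
  have h5 : t * (1 - e) ≤ t * ((seqLaw (flipLaw μ ν s c θ)).prod f.auxLaw).real
      {p | f.Accepts p.2 p.1 θ} := mul_le_mul_of_nonneg_left (by linarith) ht0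
  linarith

lemma perfRatio_flipAttack_le (hμν : μ ≪ ν) (hνμ : ν ≪ μ) (hμ : Integrable (llr μ ν) μ)
    (hν : Integrable (llr μ ν) ν) (hI0 : 0 < klZero μ ν) (hI1 : 0 < klOne μ ν) (h : 2 * c < s)
    (f : Detector s) {e : ℝ} (hfe : errorLevel μ ν f (flipAttack μ ν h) = e) (he0 : 0 < e)
    (he1 : e ≤ 1) (hpos : 0 < (1 - e) * Real.log (1 / e) - 1) :
    perfRatio μ ν f (flipAttack μ ν h) ≤
      ENNReal.ofReal (((s : ℝ) - 2 * c) * min (klZero μ ν) (klOne μ ν) *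
        (Real.log (1 / e) / ((1 - e) * Real.log (1 / e) - 1))) := by
  have hsc : (0 : ℝ) < (s : ℝ) - 2 * c := by
    have : (2 * c : ℝ) < s := by exact_mod_cast h
    linarith
  rw [perfRatio, hfe]
  set D := delay μ ν f (flipAttack μ ν h) with hD
  by_cases hDt : D = ⊤
  · rw [hDt, ENNReal.div_top]; exact zero_le
  have hα : acceptProb μ ν f (flipAttack μ ν h) false true ≤ e :=
    hfe ▸ le_max_left _ _
  have hβ : acceptProb μ ν f (flipAttack μ ν h) true false ≤ e :=
    hfe ▸ le_max_right _ _
  have hT0 : meanTime μ ν f (flipAttack μ ν h) false ≤ D := le_max_left _ _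
  have hT1 : meanTime μ ν f (flipAttack μ ν h) true ≤ D := le_max_right _ _
  have h0 := log_mul_one_sub_acceptProb_le hμν hνμ hμ hν h false
    (by rw [integral_stateLLR_false]; exact hI0.le) f he0 he1 hβ hα
    (ne_top_of_le_ne_top hDt hT0)
  have h1 := log_mul_one_sub_acceptProb_le hμν hνμ hμ hν h true
    (by rw [integral_stateLLR_true]; exact hI1.le) f he0 he1 hα hβ
    (ne_top_of_le_ne_top hDt hT1)
  rw [integral_stateLLR_false] at h0
  rw [integral_stateLLR_true] at h1
  set t := Real.log (1 / e)
  have h0' : (1 - e) * t - 1 ≤ ((s : ℝ) - 2 * c) * klZero μ ν * D.toReal :=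
    h0.trans (mul_le_mul_of_nonneg_left (ENNReal.toReal_mono hDt hT0) (by positivity))
  have h1' : (1 - e) * t - 1 ≤ ((s : ℝ) - 2 * c) * klOne μ ν * D.toReal :=
    h1.trans (mul_le_mul_of_nonneg_left (ENNReal.toReal_mono hDt hT1) (by positivity))
  -- The delay dominates both mean times, so the bound holds with the smaller of the two
  -- divergences.
  have h2 : (1 - e) * t - 1 ≤
      ((s : ℝ) - 2 * c) * min (klZero μ ν) (klOne μ ν) * D.toReal := by
    rcases min_choice (klZero μ ν) (klOne μ ν) with h | h <;> rw [h] <;> assumption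
  have hmin : 0 < min (klZero μ ν) (klOne μ ν) := lt_min hI0 hI1
  have hDpos : 0 < D.toReal := by
    by_contra hcon
    have : D.toReal = 0 := le_antisymm (not_lt.1 hcon) ENNReal.toReal_nonneg
    rw [this] at h2
    linarith
  have ht : 0 ≤ t := Real.log_nonneg (by rw [le_div_iff₀ he0]; linarith)
  conv_lhs => rw [← ENNReal.ofReal_toReal hDt, ← ENNReal.ofReal_div_of_pos hDpos]
  apply ENNReal.ofReal_le_ofReal
  rw [div_le_iff₀ hDpos]
  have h3 : t * ((1 - e) * t - 1) ≤
      t * (((s : ℝ) - 2 * c) * min (klZero μ ν) (klOne μ ν) * D.toReal) :=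
    mul_le_mul_of_nonneg_left h2 ht
  rw [← le_div_iff₀ hpos] at h3
  calc t ≤ _ := h3
    _ = _ := by ring

lemma tendsto_log_div :
    Tendsto (fun e : ℝ => Real.log (1 / e) / ((1 - e) * Real.log (1 / e) - 1)) (𝓝[>] 0) (𝓝 1) := by
  have hlog : Tendsto (fun e : ℝ => Real.log (1 / e)) (𝓝[>] 0) atTop := by
    simp only [one_div]
    exact Real.tendsto_log_atTop.comp tendsto_inv_nhdsGT_zero
  have h1 : Tendsto (fun e : ℝ => 1 / ((1 - e) - (Real.log (1 / e))⁻¹)) (𝓝[>] 0) (𝓝 1) := by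
    have h2 : Tendsto (fun e : ℝ => (1 - e) - (Real.log (1 / e))⁻¹) (𝓝[>] 0) (𝓝 1) := by
      have h3 : Tendsto (fun e : ℝ => 1 - e) (𝓝[>] 0) (𝓝 1) := by
        have : Tendsto (fun e : ℝ => 1 - e) (𝓝 0) (𝓝 (1 - 0)) := by
          exact (continuous_const.sub continuous_id).tendsto 0
        rw [sub_zero] at this
        exact this.mono_left nhdsWithin_le_nhds
      simpa using h3.sub (tendsto_inv_atTop_zero.comp hlog)
    simpa using h2.inv₀ one_ne_zero
  refine h1.congr' ?_
  filter_upwards [hlog.eventually_gt_atTop 0] with e he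
  have h2 : (1 - e) * Real.log (1 / e) - 1 =
      Real.log (1 / e) * ((1 - e) - (Real.log (1 / e))⁻¹) := by
    field_simp
  rw [h2, ← div_div, div_self he.ne']

lemma limsup_perfRatio_flipAttack_le (hμν : μ ≪ ν) (hνμ : ν ≪ μ) (hμ : Integrable (llr μ ν) μ)
    (hν : Integrable (llr μ ν) ν) (hI0 : 0 < klZero μ ν) (hI1 : 0 < klOne μ ν) (h : 2 * c < s)
    {P : Type*} (f : P → Detector s) {l : Filter P}
    (hl : Tendsto (fun p => errorLevel μ ν (f p) (flipAttack μ ν h)) l (𝓝[>] 0)) :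
    limsup (fun p => perfRatio μ ν (f p) (flipAttack μ ν h)) l ≤ gameValue μ ν s c := by
  -- If the errors cannot be made small along the family, the filter may be trivial; the upper limit
  -- is then `⊥`.
  rcases l.eq_or_neBot with hbot | hne
  · rw [hbot, limsup_bot]; exact bot_le
  have h1 := (tendsto_log_div.comp hl).const_mul
    (((s : ℝ) - 2 * c) * min (klZero μ ν) (klOne μ ν))
  rw [mul_one] at h1
  have h2 := (ENNReal.continuous_ofReal.tendsto _).comp h1
  rw [gameValue, ← h2.limsup_eq]
  refine limsup_le_limsup ?_
  have hpos : ∀ᶠ e : ℝ in 𝓝[>] 0, 0 < e ∧ e ≤ 1 ∧ 0 < (1 - e) * Real.log (1 / e) - 1 := by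
    have hlog : Tendsto (fun e : ℝ => Real.log (1 / e)) (𝓝[>] 0) atTop := by
      simp only [one_div]
      exact Real.tendsto_log_atTop.comp tendsto_inv_nhdsGT_zero
    filter_upwards [self_mem_nhdsWithin, hlog.eventually_gt_atTop 2,
      mem_nhdsWithin_of_mem_nhds (Iio_mem_nhds (by norm_num : (0 : ℝ) < 1 / 2))] with e he h2 h3
    have h3' : e < 1 / 2 := h3
    exact ⟨he, by linarith, by nlinarith⟩
  filter_upwards [hl.eventually hpos] with p hp
  exact perfRatio_flipAttack_le hμν hνμ hμ hν hI0 hI1 h (f p) rfl hp.1 hp.2.1 hp.2.2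

end Flip

/-! ### Mean first passage times of random walks with positive drift. -/

section FirstPassage

variable {X : Type*}

/-- The event that none of the first `k` partial sums has reached the level `b`. -/
def notReached (φ : X → ℝ) (b : ℝ) (k : ℕ) : Set (ℕ → X) :=
  {x | ∀ j < k, partialSum φ (j + 1) x < b}

lemma notReached_antitone (φ : X → ℝ) (b : ℝ) : Antitone (notReached φ b) :=
  fun _ _ hkl _ hx j hj => hx j (hj.trans_le hkl)

lemma notReached_mono (φ : X → ℝ) (k : ℕ) {b b' : ℝ} (h : b ≤ b') :
    notReached φ b k ⊆ notReached φ b' k :=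
  fun _ hx j hj => (hx j hj).trans_le h

lemma partialSum_lt_of_mem_notReached {φ : X → ℝ} {b : ℝ} (hb : 0 < b) {k : ℕ} {x : ℕ → X}
    (hx : x ∈ notReached φ b k) : partialSum φ k x < b := by
  rcases k with _ | k
  · simpa [partialSum] using hb
  · exact hx k k.lt_succ_self

-- Until the passage over `b`, the truncated increments after `n₀` add up to at most the growth of
-- the walk, which stays below `b ≤ L`. The step that crosses adds at most `K`, which is why the
-- increments are truncated.
open Classical in
lemma sum_truncated_le {φ : X → ℝ} {b K L : ℝ} (hb : 0 < b) (hK : 0 ≤ K) (hL : b ≤ L) (n₀ d : ℕ)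
    (x : ℕ → X) :
    ∑ k ∈ Finset.range d, (if x ∈ notReached φ b (n₀ + k) then min (φ (x (n₀ + k))) K else 0) ≤
      |L - partialSum φ n₀ x| + K := by
  by_cases h0 : x ∈ notReached φ b n₀
  -- The induction also carries the comparison with the walk itself, available as long as the level
  -- has not been reached.
  · suffices h : (x ∈ notReached φ b (n₀ + d) →
        ∑ k ∈ Finset.range d,
          (if x ∈ notReached φ b (n₀ + k) then min (φ (x (n₀ + k))) K else 0) ≤
          partialSum φ (n₀ + d) x - partialSum φ n₀ x) ∧
        ∑ k ∈ Finset.range d,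
          (if x ∈ notReached φ b (n₀ + k) then min (φ (x (n₀ + k))) K else 0) ≤
          |L - partialSum φ n₀ x| + K from h.2
    induction d with
    | zero =>
      refine ⟨fun _ => by simp, ?_⟩
      rw [Finset.sum_range_zero]; positivity
    | succ d ih =>
      rw [Finset.sum_range_succ]
      by_cases hx : x ∈ notReached φ b (n₀ + d)
      · rw [if_pos hx]
        have h1 := ih.1 hx
        have h2 := partialSum_lt_of_mem_notReached hb hx
        have h3 : partialSum φ (n₀ + (d + 1)) x =
            partialSum φ (n₀ + d) x + φ (x (n₀ + d)) := Finset.sum_range_succ _ _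
        have h4 := min_le_left (φ (x (n₀ + d))) K
        have h5 := min_le_right (φ (x (n₀ + d))) K
        have h6 := le_abs_self (L - partialSum φ n₀ x)
        exact ⟨fun _ => by linarith, by linarith⟩
      · rw [if_neg hx, add_zero]
        exact ⟨fun hx' => absurd (notReached_antitone φ b (by omega) hx') hx, ih.2⟩
  · rw [Finset.sum_eq_zero fun k _ => if_neg fun hx =>
      h0 (notReached_antitone φ b (by omega) hx)]
    positivity

variable [MeasurableSpace X]

lemma measurableSet_past_notReached {φ : X → ℝ} (hφ : Measurable φ) (b : ℝ) (k : ℕ) :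
    MeasurableSet[past X k] (notReached φ b k) := by
  have h : notReached φ b k = ⋂ j, ⋂ (_ : j < k), partialSum φ (j + 1) ⁻¹' Set.Iio b := by
    ext x; simp [notReached]
  rw [h]
  exact MeasurableSet.iInter fun j => MeasurableSet.iInter fun hj =>
    measurable_past_partialSum hφ hj measurableSet_Iio

/-- By dominated convergence, truncation from above at a high level keeps the mean positive. It
permits a bounded overshoot with first moments only. -/
lemma exists_integral_min_pos {P : Measure X} [IsProbabilityMeasure P] {φ : X → ℝ}
    (hint : Integrable φ P) (hm : 0 < ∫ y, φ y ∂P) :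
    ∃ K : ℝ, 0 ≤ K ∧ 0 < ∫ y, min (φ y) K ∂P := by
  have h : Tendsto (fun n : ℕ => ∫ y, min (φ y) n ∂P) atTop (𝓝 (∫ y, φ y ∂P)) := by
    refine tendsto_integral_of_dominated_convergence (fun y => |φ y|)
      (fun n => hint.aestronglyMeasurable.inf aestronglyMeasurable_const) hint.abs
      (fun n => ae_of_all _ fun y => ?_) (ae_of_all _ fun y => ?_)
    · rw [Real.norm_eq_abs, abs_le]
      have hn : (0 : ℝ) ≤ n := n.cast_nonneg
      exact ⟨le_min (neg_abs_le _) ((neg_nonpos.2 (abs_nonneg _)).trans hn),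
        (min_le_left _ _).trans (le_abs_self _)⟩
    · refine tendsto_const_nhds.congr' ?_
      filter_upwards [tendsto_natCast_atTop_atTop.eventually_ge_atTop (φ y)] with n hn
      exact (min_eq_left hn).symm
  obtain ⟨n, hn⟩ := (h.eventually_const_lt hm).exists
  exact ⟨n, n.cast_nonneg, hn⟩

variable {P : Measure X} [IsProbabilityMeasure P] {φ : X → ℝ}

/-- The left side is the mean excess of the passage time over `n₀`. Whether the level has been
reached by time `k` is independent of the next increment, so each unit of excess contributes the
truncated mean to the expectation of the sum in `sum_truncated_le`. -/
lemma tsum_notReached_le (hφ : Measurable φ) (hint : Integrable φ P) {K : ℝ} (hK : 0 ≤ K)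
    (hK' : 0 < ∫ y, min (φ y) K ∂P) {b L : ℝ} (hb : 0 < b) (hL : b ≤ L) (n₀ : ℕ) :
    ∑' k, seqLaw P (notReached φ b (n₀ + k)) ≤
      ENNReal.ofReal ((∫ x, |L - partialSum φ n₀ x| ∂seqLaw P + K) /
        ∫ y, min (φ y) K ∂P) := by
  classical
  refine ENNReal.tsum_le_of_sum_range_le fun d => ?_
  have hψ : Measurable fun y => min (φ y) K := hφ.min measurable_const
  have hψi : Integrable (fun y => min (φ y) K) P := hint.inf (integrable_const K)
  have hN := fun k => measurableSet_past_notReached hφ b k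
  have h1 : ∀ k, ∫ x, (if x ∈ notReached φ b k then min (φ (x k)) K else 0) ∂seqLaw P =
      (seqLaw P).real (notReached φ b k) * ∫ y, min (φ y) K ∂P := by
    intro k
    rw [seqLaw, ← setIntegral_past_apply P hψ (hN k), ← integral_indicator (past_le _ _ (hN k))]
    rfl
  have h2 : ∀ k, Integrable (fun x => if x ∈ notReached φ b k then min (φ (x k)) K else 0)
      (seqLaw P) := fun k =>
    (integrable_comp_apply hψi k).indicator (past_le _ _ (hN k))
  have h3 : (∑ k ∈ Finset.range d, (seqLaw P).real (notReached φ b (n₀ + k))) *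
      ∫ y, min (φ y) K ∂P ≤ ∫ x, |L - partialSum φ n₀ x| ∂seqLaw P + K := by
    rw [Finset.sum_mul, Finset.sum_congr rfl fun k _ => (h1 (n₀ + k)).symm,
      ← integral_finsetSum _ fun k _ => h2 (n₀ + k)]
    have h4 : Integrable (fun x => |L - partialSum φ n₀ x|) (seqLaw P) :=
      ((integrable_const L).sub (integrable_partialSum hint n₀)).abs
    have h5 : ∫ x, |L - partialSum φ n₀ x| ∂seqLaw P + K =
        ∫ x, (|L - partialSum φ n₀ x| + K) ∂seqLaw P := by
      rw [integral_add h4 (integrable_const K)]; simp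
    rw [h5]
    exact integral_mono (integrable_finsetSum _ fun k _ => h2 (n₀ + k))
      (h4.add (integrable_const K)) fun x => sum_truncated_le hb hK hL n₀ d x
  rw [← le_div_iff₀ hK'] at h3
  refine le_trans (le_of_eq ?_) (ENNReal.ofReal_le_ofReal h3)
  rw [ENNReal.ofReal_sum_of_nonneg fun _ _ => measureReal_nonneg]
  exact Finset.sum_congr rfl fun k _ => (ofReal_measureReal).symm

lemma tendsto_integral_abs_mean_sub (hφ : Measurable φ) (hint : Integrable φ P) :
    Tendsto (fun n : ℕ => ∫ x, |(n : ℝ)⁻¹ * partialSum φ n x - ∫ y, φ y ∂P| ∂seqLaw P) atTop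
      (𝓝 0) := by
  have hmp := fun k => measurePreserving_eval_infinitePi (fun _ : ℕ => P) k
  have hind : iIndepFun (fun (k : ℕ) (x : ℕ → X) => φ (x k)) (seqLaw P) :=
    iIndepFun_infinitePi (X := fun _ => φ) (fun _ => hφ)
  have hid : ∀ k, IdentDistrib (fun x : ℕ → X => φ (x k)) (fun x => φ (x 0))
      (seqLaw P) (seqLaw P) := fun k =>
    (⟨(hmp k).aemeasurable, (hmp 0).aemeasurable, (hmp k).map_eq.trans (hmp 0).map_eq.symm⟩ :
      IdentDistrib (fun x : ℕ → X => x k) (fun x => x 0) (seqLaw P) (seqLaw P)).comp hφ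
  have h := strong_law_Lp (μ := seqLaw P) (p := 1) le_rfl ENNReal.one_ne_top
    (fun k (x : ℕ → X) => φ (x k)) (memLp_one_iff_integrable.2 (integrable_comp_apply hint 0))
    (fun i j hij => hind.indepFun hij) hid
  have hmean : ∫ x, φ (x 0) ∂seqLaw P = ∫ y, φ y ∂P :=
    (hmp 0).hasLaw.integral_comp hφ.aestronglyMeasurable
  rw [hmean] at h
  have h2 := (ENNReal.tendsto_toReal ENNReal.zero_ne_top).comp h
  rw [ENNReal.toReal_zero] at h2
  refine h2.congr fun n => ?_
  simp only [Function.comp, eLpNorm_one_eq_lintegral_enorm, smul_eq_mul]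
  rw [← integral_norm_eq_lintegral_enorm]
  · rfl
  · exact (((integrable_partialSum hint n).const_mul _).sub
      (integrable_const _)).aestronglyMeasurable

lemma eventually_integral_abs_sub_le (hφ : Measurable φ) (hint : Integrable φ P) {δ : ℝ}
    (hδ : 0 < δ) : ∀ᶠ n : ℕ in atTop,
      ∫ x, |(n : ℝ) * (∫ y, φ y ∂P) - partialSum φ n x| ∂seqLaw P ≤ δ * n := by
  filter_upwards [(tendsto_integral_abs_mean_sub hφ hint).eventually_le_const hδ,
    eventually_gt_atTop 0] with n hn hn0
  have hn0' : (0 : ℝ) < n := by exact_mod_cast hn0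
  have h : ∀ x, |(n : ℝ) * (∫ y, φ y ∂P) - partialSum φ n x| =
      n * |(n : ℝ)⁻¹ * partialSum φ n x - ∫ y, φ y ∂P| := by
    intro x
    rw [← abs_of_pos hn0', ← abs_mul, abs_of_pos hn0', abs_sub_comm, mul_sub,
      mul_inv_cancel_left₀ hn0'.ne']
  simp only [h]
  rw [integral_const_mul, mul_comm]
  exact mul_le_mul_of_nonneg_right hn hn0'.le

/-- Apply the preceding bound from the time `n ≈ b / m` at which the walk is expected to arrive,
with `L = n m`: by the law of large numbers in `L¹`, `E|n m - S_n|` is `o(n)`. -/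
lemma exists_tsum_notReached_le (hφ : Measurable φ) (hint : Integrable φ P)
    (hm : 0 < ∫ y, φ y ∂P) {ε : ℝ} (hε : 0 < ε) :
    ∃ B : ℝ, 0 < B ∧ ∀ b ≥ B,
      ∑' k, seqLaw P (notReached φ b (⌈b / ∫ y, φ y ∂P⌉₊ + k)) ≤ ENNReal.ofReal (ε * b) := by
  set m := ∫ y, φ y ∂P with hm_def
  obtain ⟨K, hK, hK'⟩ := exists_integral_min_pos hint hm
  set m' := ∫ y, min (φ y) K ∂P with hm'
  obtain ⟨n₁, hn₁⟩ := eventually_atTop.1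
    (eventually_integral_abs_sub_le hφ hint (δ := ε * m * m' / 4) (by positivity))
  -- The bound `m` absorbs the rounding of `b / m`, `n₁ * m` makes `n` large enough for the law of
  -- large numbers, and the third term makes `K` at most half of `ε * b * m'`.
  refine ⟨max (max m (n₁ * m)) (2 * K / (ε * m')), by positivity, fun b hb => ?_⟩
  have hb1 : m ≤ b := (le_max_left _ _).trans ((le_max_left _ _).trans hb)
  have hb2 : n₁ * m ≤ b := (le_max_right _ _).trans ((le_max_left _ _).trans hb)
  have hb3 : 2 * K / (ε * m') ≤ b := (le_max_right _ _).trans hb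
  have hb0 : 0 < b := hm.trans_le hb1
  set n := ⌈b / m⌉₊ with hn
  have hnb : b ≤ n * m := by
    have := Nat.le_ceil (b / m)
    rwa [div_le_iff₀ hm] at this
  have hn2 : (n : ℝ) * m ≤ 2 * b := by
    have := (Nat.ceil_lt_add_one (div_pos hb0 hm).le).le
    have h2 : (n : ℝ) * m ≤ (b / m + 1) * m := mul_le_mul_of_nonneg_right this hm.le
    rw [add_mul, div_mul_cancel₀ _ hm.ne', one_mul] at h2
    linarith
  have hnn : n₁ ≤ n := by
    have : (n₁ : ℝ) ≤ n := by
      refine ((le_div_iff₀ hm).2 hb2).trans (Nat.le_ceil _)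
    exact_mod_cast this
  refine (tsum_notReached_le hφ hint hK hK' hb0 hnb n).trans (ENNReal.ofReal_le_ofReal ?_)
  rw [← hm', div_le_iff₀ hK']
  have h1 := hn₁ n hnn
  rw [div_le_iff₀ (by positivity)] at hb3
  have h2 : ε * m * m' / 4 * n ≤ ε * m' / 2 * b := by
    have : ε * m * m' / 4 * n = ε * m' / 4 * (n * m) := by ring
    rw [this]
    have h3 : ε * m' / 4 * (n * m) ≤ ε * m' / 4 * (2 * b) :=
      mul_le_mul_of_nonneg_left hn2 (by positivity)
    linarith
  linarith

end FirstPassage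

/-! ### Pathwise properties of the voting rule under an arbitrary attack. -/

section VotingRule

variable {s c : ℕ}

open Classical in
/-- The number of sensors that have voted for `d` by the time `k + 1`, when a sensor votes for `d`
as soon as its cumulative log-likelihood ratio of `d` against the other state reaches `t`. -/
noncomputable def votes (μ ν : Measure ℝ) (t : ℝ) (d : Bool) (y : ℕ → Fin s → ℝ) (k : ℕ) : ℕ :=
  (Finset.univ.filter fun i =>
    (fun l => y l i) ∉ notReached (stateLLR μ ν d) t (k + 1)).card

/-- The threshold of a vote for `d`. -/
def threshold (a b : ℝ) : Bool → ℝ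
  | false => a
  | true => b

variable {μ ν : Measure ℝ}

lemma cumLLR_eq_partialSum (y : ℕ → Fin s → ℝ) (i : Fin s) {k : ℕ} (j : Fin (k + 1)) :
    cumLLR μ ν (fun (l : Fin (k + 1)) i => y l i) i j =
      partialSum (stateLLR μ ν true) (j + 1) fun l => y l i := by
  have h : (Finset.Iic j).map Fin.valEmbedding = Finset.range (j + 1) := by
    rw [Fin.map_valEmbedding_Iic]
    ext l; simp
  rw [cumLLR, partialSum, ← h, Finset.sum_map]
  rfl

lemma partialSum_stateLLR_false (n : ℕ) (z : ℕ → ℝ) :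
    partialSum (stateLLR μ ν false) n z = -partialSum (stateLLR μ ν true) n z :=
  Finset.sum_neg_distrib _

lemma upVotes_eq_votes (b : ℝ) (y : ℕ → Fin s → ℝ) (k : ℕ) :
    upVotes μ ν b (fun (l : Fin (k + 1)) i => y l i) = votes μ ν b true y k := by
  unfold upVotes votes
  refine congrArg Finset.card (Finset.ext fun i => ?_)
  simp only [Finset.mem_filter, Finset.mem_univ, true_and, cumLLR_eq_partialSum, notReached, Set.mem_ofPred_eq,
    not_forall, not_lt]
  exact ⟨fun ⟨j, hj⟩ => ⟨j, j.2, hj⟩, fun ⟨j, hj, h⟩ => ⟨⟨j, hj⟩, h⟩⟩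

lemma downVotes_eq_votes (a : ℝ) (y : ℕ → Fin s → ℝ) (k : ℕ) :
    downVotes μ ν a (fun (l : Fin (k + 1)) i => y l i) = votes μ ν a false y k := by
  unfold downVotes votes
  refine congrArg Finset.card (Finset.ext fun i => ?_)
  simp only [Finset.mem_filter, Finset.mem_univ, true_and, cumLLR_eq_partialSum, notReached, Set.mem_ofPred_eq,
    not_forall, not_lt, partialSum_stateLLR_false]
  exact ⟨fun ⟨j, hj⟩ => ⟨j, j.2, by linarith⟩, fun ⟨j, hj, h⟩ => ⟨⟨j, hj⟩, by simp only; linarith⟩⟩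

lemma at_votingDetector (r : ℕ) (a b : ℝ) (coin : Bool) (y : ℕ → Fin s → ℝ) (k : ℕ) :
    (votingDetector μ ν r a b : Detector s).at coin y k =
      if r ≤ votes μ ν a false y k then
        if r ≤ votes μ ν b true y k then some coin else some false
      else
        if r ≤ votes μ ν b true y k then some true else none := by
  change voteRule μ ν r a b (fun (l : Fin (k + 1)) i => y l i) coin = _
  rw [voteRule, upVotes_eq_votes, downVotes_eq_votes]

lemma votes_lt_of_at_eq_none {r : ℕ} {a b : ℝ} {coin : Bool} {y : ℕ → Fin s → ℝ} {k : ℕ}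
    (h : (votingDetector μ ν r a b : Detector s).at coin y k = none) (d : Bool) :
    votes μ ν (threshold a b d) d y k < r := by
  rw [at_votingDetector] at h
  cases d <;> simp only [threshold] <;> by_contra hlt <;> rw [not_lt] at hlt <;>
    split_ifs at h

lemma le_votes_of_at_eq_some {r : ℕ} {a b : ℝ} {coin : Bool} {y : ℕ → Fin s → ℝ} {k : ℕ}
    {d : Bool} (h : (votingDetector μ ν r a b : Detector s).at coin y k = some d) :
    r ≤ votes μ ν (threshold a b d) d y k := by
  rw [at_votingDetector] at h
  split_ifs at h with h1 h2 h2 <;> cases d <;> simp_all [threshold]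

lemma received_honest (g : Attack s c) (θ : Bool) (v : g.Aux) (x : ℕ → Fin s → ℝ) {i : Fin s}
    (hi : i ∉ g.comp θ) (k : ℕ) : received g θ v x k i = x k i := by
  change x k i + biasSeq g θ v x k i = x k i
  rw [biasSeq, g.bias_honest θ k v _ _ i hi, add_zero]

lemma card_honest (g : Attack s c) (θ : Bool) : (g.comp θ)ᶜ.card = s - c := by
  rw [Finset.card_compl, g.card_comp, Fintype.card_fin]

lemma le_votes_of_honest {t : ℝ} {d : Bool} {y : ℕ → Fin s → ℝ} {k : ℕ} {H : Finset (Fin s)}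
    (h : ∀ i ∈ H, (fun l => y l i) ∉ notReached (stateLLR μ ν d) t (k + 1)) :
    H.card ≤ votes μ ν t d y k := by
  classical
  exact Finset.card_le_card fun i hi => Finset.mem_filter.2 ⟨Finset.mem_univ i, h i hi⟩

lemma exists_honest_of_votes_lt {t : ℝ} {d : Bool} {y : ℕ → Fin s → ℝ} {k : ℕ}
    {H : Finset (Fin s)} (h : votes μ ν t d y k < H.card) :
    ∃ i ∈ H, (fun l => y l i) ∈ notReached (stateLLR μ ν d) t (k + 1) := by
  by_contra hcon
  push Not at hcon
  exact absurd (le_votes_of_honest hcon) (not_le.2 h)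

/-- The `s - c` honest sensors alone could decide for the true state, so one of them has not yet
voted for it. -/
lemma exists_notReached_of_continue (h : 2 * c < s) (g : Attack s c) (θ : Bool) (v : g.Aux)
    (x : ℕ → Fin s → ℝ) (a b : ℝ) (coin : Bool) (k : ℕ)
    (hk : ∀ j < k, (votingDetector μ ν (s - c) a b : Detector s).at coin
      (received g θ v x) j = none) :
    ∃ i, (fun l => x l i) ∈ notReached (stateLLR μ ν θ) (threshold a b θ) k := by
  rcases k with _ | k
  -- At time `0` nothing has been observed, and any sensor will do.
  · exact ⟨⟨0, by omega⟩, fun j hj => absurd hj (Nat.not_lt_zero j)⟩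
  · have h1 := votes_lt_of_at_eq_none (hk k k.lt_succ_self) θ
    rw [← card_honest g θ] at h1
    obtain ⟨i, hi, hx⟩ := exists_honest_of_votes_lt h1
    simp only [received_honest g θ v x (Finset.mem_compl.1 hi)] at hx
    exact ⟨i, hx⟩

/-- Of the `s - c` votes for `d` at most `c` come from compromised sensors. The honest votes depend
on the true observations only, whatever the attack does. -/
lemma exists_subset_of_accepts (h : 2 * c < s) (g : Attack s c) (θ : Bool) (v : g.Aux)
    (x : ℕ → Fin s → ℝ) (a b : ℝ) (coin d : Bool)
    (hacc : (votingDetector μ ν (s - c) a b : Detector s).Accepts coin (received g θ v x) d) :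
    ∃ A : Finset (Fin s), A.card = s - 2 * c ∧ ∀ i ∈ A, (fun l => x l i) ∈
      {z | ∃ k, threshold a b d ≤ partialSum (stateLLR μ ν d) (k + 1) z} := by
  classical
  obtain ⟨k, hk, -⟩ := hacc
  have h1 := le_votes_of_at_eq_some hk
  rw [votes] at h1
  set F := Finset.univ.filter fun i => (fun l => received g θ v x l i) ∉
    notReached (stateLLR μ ν d) (threshold a b d) (k + 1) with hF
  have h2 : s - 2 * c ≤ (F \ g.comp θ).card := by
    have h3 := Finset.le_card_sdiff (g.comp θ) F
    rw [g.card_comp] at h3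
    omega
  obtain ⟨A, hA, hcard⟩ := Finset.exists_subset_card_eq h2
  refine ⟨A, hcard, fun i hi => ?_⟩
  obtain ⟨h4, h5⟩ := Finset.mem_sdiff.1 (hA hi)
  have h6 := (Finset.mem_filter.1 h4).2
  simp only [received_honest g θ v x h5, notReached, Set.mem_ofPred_eq, not_forall, not_lt] at h6
  obtain ⟨j, -, hj⟩ := h6
  exact ⟨j, hj⟩

/-- The honest sensors move steadily towards `d` and all vote for it by time `n`. Up to then only
the `c < s - c` compromised sensors can vote for the other state, so neither a wrong decision nor a
tie can occur. -/
lemma accepts_of_forall_le (h : 2 * c < s) (g : Attack s c) (θ : Bool) (v : g.Aux)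
    (x : ℕ → Fin s → ℝ) {a b : ℝ} (ha : 0 < a) (hb : 0 < b) (coin d : Bool) {δ : ℝ} (hδ : 0 < δ)
    {n : ℕ} (hn : threshold a b d ≤ n * δ) (hx : ∀ k < n, ∀ i, δ ≤ stateLLR μ ν d (x k i)) :
    (votingDetector μ ν (s - c) a b : Detector s).Accepts coin (received g θ v x) d := by
  classical
  have hthr : ∀ e, 0 < threshold a b e := by rintro (_ | _) <;> assumption
  have hn0 : n ≠ 0 := by
    rintro rfl
    have := hthr d
    simp only [Nat.cast_zero, zero_mul] at hn
    linarith
  have hsum : ∀ j ≤ n, ∀ i, j * δ ≤ partialSum (stateLLR μ ν d) j fun l => x l i := by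
    intro j hj i
    have h1 := Finset.card_nsmul_le_sum (Finset.range j) (fun l => stateLLR μ ν d (x l i)) δ
      fun l hl => hx l ((Finset.mem_range.1 hl).trans_le hj) i
    rwa [Finset.card_range, nsmul_eq_mul] at h1
  have hdecide : ∃ k, (votingDetector μ ν (s - c) a b : Detector s).at coin
      (received g θ v x) k ≠ none := by
    refine ⟨n - 1, fun hnone => ?_⟩
    have h1 := votes_lt_of_at_eq_none hnone d
    rw [← card_honest g θ] at h1
    refine absurd (le_votes_of_honest fun i hi => ?_) (not_le.2 h1)
    simp only [received_honest g θ v x (Finset.mem_compl.1 hi)]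
    intro hmem
    have h2 := hmem (n - 1) (by omega)
    rw [Nat.sub_add_cancel (Nat.one_le_iff_ne_zero.2 hn0)] at h2
    linarith [hsum n le_rfl i]
  have hlt : Nat.find hdecide < n := by
    by_contra hcon
    have h1 := not_not.1 (Nat.find_min hdecide (m := n - 1) (by omega))
    have h2 := votes_lt_of_at_eq_none h1 d
    rw [← card_honest g θ] at h2
    obtain ⟨i, hi, hmem⟩ := exists_honest_of_votes_lt h2
    simp only [received_honest g θ v x (Finset.mem_compl.1 hi)] at hmem
    have h3 := hmem (n - 1) (by omega)
    rw [Nat.sub_add_cancel (Nat.one_le_iff_ne_zero.2 hn0)] at h3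
    linarith [hsum n le_rfl i]
  obtain ⟨e, he⟩ := Option.ne_none_iff_exists'.1 (Nat.find_spec hdecide)
  refine ⟨Nat.find hdecide, ?_, fun j hj => not_not.1 (Nat.find_min hdecide hj)⟩
  by_cases hed : e = d
  · rw [← hed]; exact he
  exfalso
  have hed' : e = !d := by cases e <;> cases d <;> simp_all
  subst hed'
  have h1 := le_votes_of_at_eq_some he
  have h2 : votes μ ν (threshold a b !d) (!d) (received g θ v x) (Nat.find hdecide) ≤
      (g.comp θ).card := by
    refine Finset.card_le_card fun i hi => ?_
    by_contra hi'
    refine (Finset.mem_filter.1 hi).2 ?_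
    simp only [received_honest g θ v x hi']
    intro j hj
    have h3 := hsum (j + 1) (by omega) i
    have h4 : partialSum (stateLLR μ ν !d) (j + 1) (fun l => x l i) =
        -partialSum (stateLLR μ ν d) (j + 1) fun l => x l i := by
      cases d
      · simp [partialSum_stateLLR_false]
      · exact partialSum_stateLLR_false _ _
    have h5 : 0 < ((j + 1 : ℕ) : ℝ) * δ := by positivity
    have h6 := hthr (!d)
    linarith
  rw [g.card_comp] at h2
  omega

end VotingRule

/-! ### Error probabilities and delay of the voting detector, uniformly over attacks. -/

section VotingPerformance

variable {μ ν : Measure ℝ} [IsProbabilityMeasure μ] [IsProbabilityMeasure ν] {s c : ℕ}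

lemma measurePreserving_jointLaw_fst (f : Detector s) (g : Attack s c) (θ : Bool) :
    MeasurePreserving Prod.fst (jointLaw μ ν f g θ) (iidLaw s (stateLaw μ ν θ)) :=
  measurePreserving_fst

instance (f : Detector s) (g : Attack s c) (θ : Bool) :
    IsProbabilityMeasure (jointLaw μ ν f g θ) := by
  unfold jointLaw; infer_instance

/-- A union bound over the sets of `s - 2c` honest wrong voters, where independence turns Ville's
bound for one sensor into its power of order `s - 2c`. -/
lemma acceptProb_voting_le (hμν : μ ≪ ν) (hνμ : ν ≪ μ) (h : 2 * c < s) (g : Attack s c)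
    (a b : ℝ) (d : Bool) :
    acceptProb μ ν (votingDetector μ ν (s - c) a b) g (!d) d ≤
      (s.choose (s - 2 * c) : ℝ) * Real.exp (-(((s : ℝ) - 2 * c) * threshold a b d)) := by
  set f : Detector s := votingDetector μ ν (s - c) a b
  set E : Set (ℕ → ℝ) :=
    {z | ∃ k, threshold a b d ≤ partialSum (stateLLR μ ν d) (k + 1) z} with hE
  have hEm : MeasurableSet E := by
    rw [hE]
    simp only [Set.ofPred_exists]
    exact MeasurableSet.iUnion fun k =>
      measurable_partialSum (measurable_stateLLR d) (k + 1) measurableSet_Ici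
  have hville : seqLaw (stateLaw μ ν !d) E ≤ ENNReal.ofReal (Real.exp (-threshold a b d)) :=
    seqLaw_exists_le_partialSum (measurable_stateLLR d) (isExpTilt_stateLLR hμν hνμ d) _
  have hsub : {ω : (ℕ → Fin s → ℝ) × g.Aux × f.Aux |
      f.Accepts ω.2.2 (received g (!d) ω.2.1 ω.1) d} ⊆
      Prod.fst ⁻¹' ⋃ A ∈ Finset.powersetCard (s - 2 * c) (Finset.univ : Finset (Fin s)),
        {x : ℕ → Fin s → ℝ | ∀ i ∈ A, (fun l => x l i) ∈ E} := by
    intro ω hω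
    obtain ⟨A, hA, hx⟩ := exists_subset_of_accepts h g (!d) ω.2.1 ω.1 a b ω.2.2 d hω
    exact Set.mem_biUnion (Finset.mem_powersetCard.2 ⟨Finset.subset_univ A, hA⟩) hx
  have hmeas : ∀ A : Finset (Fin s),
      MeasurableSet {x : ℕ → Fin s → ℝ | ∀ i ∈ A, (fun l => x l i) ∈ E} := by
    intro A
    simp only [Set.ofPred_forall]
    exact MeasurableSet.iInter fun i => MeasurableSet.iInter fun _ =>
      hEm.preimage (by fun_prop : Measurable fun (x : ℕ → Fin s → ℝ) l => x l i)
  have hle : jointLaw μ ν f g (!d) {ω | f.Accepts ω.2.2 (received g (!d) ω.2.1 ω.1) d} ≤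
      (s.choose (s - 2 * c) : ℝ≥0∞) *
        ENNReal.ofReal (Real.exp (-threshold a b d)) ^ (s - 2 * c) := by
    refine (measure_mono hsub).trans ?_
    rw [(measurePreserving_jointLaw_fst f g (!d)).measure_preimage
      (Finset.measurableSet_biUnion _ fun A _ => hmeas A).nullMeasurableSet]
    refine (measure_biUnion_finset_le _ _).trans ?_
    calc ∑ A ∈ Finset.powersetCard (s - 2 * c) (Finset.univ : Finset (Fin s)),
          iidLaw s (stateLaw μ ν !d) {x | ∀ i ∈ A, (fun l => x l i) ∈ E}
        ≤ ∑ A ∈ Finset.powersetCard (s - 2 * c) (Finset.univ : Finset (Fin s)),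
          ENNReal.ofReal (Real.exp (-threshold a b d)) ^ (s - 2 * c) := by
          refine Finset.sum_le_sum fun A hA => ?_
          rw [iidLaw_forall_mem _ A hEm, (Finset.mem_powersetCard.1 hA).2]
          exact pow_le_pow_left' hville _
      _ = _ := by
          rw [Finset.sum_const, Finset.card_powersetCard, Finset.card_univ, Fintype.card_fin,
            nsmul_eq_mul]
  have h2 := ENNReal.toReal_mono (by finiteness) hle
  rw [ENNReal.toReal_mul, ENNReal.toReal_pow, ENNReal.toReal_ofReal (Real.exp_pos _).le,
    ENNReal.toReal_natCast, ← Real.exp_nat_mul, Nat.cast_sub h.le] at h2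
  push_cast at h2
  rw [mul_neg] at h2
  exact h2

/-- With positive probability the first `n` observations of all sensors mislead by at least `δ`
each, which forces the wrong decision under every attack. -/
lemma le_acceptProb_voting (h : 2 * c < s) (g : Attack s c) {a b : ℝ} (ha : 0 < a) (hb : 0 < b)
    (d : Bool) {δ : ℝ} (hδ : 0 < δ) {n : ℕ} (hn : threshold a b d ≤ n * δ) :
    ((stateLaw μ ν !d).real {y | δ ≤ stateLLR μ ν d y} ^ s) ^ n ≤
      acceptProb μ ν (votingDetector μ ν (s - c) a b) g (!d) d := by
  set f : Detector s := votingDetector μ ν (s - c) a b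
  have hm : MeasurableSet {y | δ ≤ stateLLR μ ν d y} :=
    measurable_stateLLR d measurableSet_Ici
  have hM : MeasurableSet
      {x : ℕ → Fin s → ℝ | ∀ k < n, ∀ i, x k i ∈ {y | δ ≤ stateLLR μ ν d y}} := by
    simp only [Set.ofPred_forall]
    exact MeasurableSet.iInter fun k => MeasurableSet.iInter fun _ => MeasurableSet.iInter fun i =>
      hm.preimage (by fun_prop : Measurable fun x : ℕ → Fin s → ℝ => x k i)
  have h1 := congrArg ENNReal.toReal (iidLaw_forall_lt_mem (s := s) (stateLaw μ ν !d) n hm)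
  rw [ENNReal.toReal_pow, ENNReal.toReal_pow] at h1
  simp only [← measureReal_def] at h1
  rw [← h1, ← (measurePreserving_jointLaw_fst f g (!d)).measureReal_preimage hM.nullMeasurableSet]
  exact measureReal_mono fun ω hω =>
    accepts_of_forall_le h g (!d) ω.2.1 ω.1 ha hb ω.2.2 d hδ hn hω

/-- The first `n` steps cost at most `n`; each later step needs a sensor that is still below the
threshold, and a union bound runs over all `s` sensors because the attack chooses the honest ones.
-/
lemma meanTime_voting_le (h : 2 * c < s) (g : Attack s c) {a b M : ℝ} (θ : Bool)
    (hM : threshold a b θ ≤ M) (n : ℕ) :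
    meanTime μ ν (votingDetector μ ν (s - c) a b) g θ ≤
      n + s * ∑' k, seqLaw (stateLaw μ ν θ) (notReached (stateLLR μ ν θ) M (n + k)) := by
  set f : Detector s := votingDetector μ ν (s - c) a b
  set N := notReached (stateLLR μ ν θ) M
  have hNm : ∀ k, MeasurableSet (N k) := fun k =>
    past_le _ _ (measurableSet_past_notReached (measurable_stateLLR θ) M k)
  have hpt : ∀ ω : (ℕ → Fin s → ℝ) × g.Aux × f.Aux,
      (f.stopTime ω.2.2 (received g θ ω.2.1 ω.1) : ℝ≥0∞) ≤
        n + ∑' k, ∑ i : Fin s, (N (n + k)).indicator (fun _ => (1 : ℝ≥0∞)) fun l => ω.1 l i := by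
    intro ω
    rw [stopTime_eq_tsum, ← (ENNReal.summable).sum_add_tsum_nat_add' (k := n)]
    refine add_le_add ?_ (ENNReal.tsum_le_tsum fun k => ?_)
    · calc ∑ k ∈ Finset.range n, _ ≤ ∑ k ∈ Finset.range n, (1 : ℝ≥0∞) :=
            Finset.sum_le_sum fun k _ => Set.indicator_le_self' (fun _ _ => zero_le) k
        _ = n := by simp
    · refine Set.indicator_apply_le' (fun hk => ?_) fun _ => zero_le
      obtain ⟨i, hi⟩ := exists_notReached_of_continue h g θ ω.2.1 ω.1 a b ω.2.2 (k + n) hk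
      rw [add_comm k n] at hi
      have h1 := Set.indicator_of_mem (notReached_mono _ _ hM hi) fun _ => (1 : ℝ≥0∞)
      calc (1 : ℝ≥0∞) = (N (n + k)).indicator (fun _ => 1) fun l => ω.1 l i := h1.symm
        _ ≤ _ := Finset.single_le_sum
            (f := fun i => (N (n + k)).indicator (fun _ => (1 : ℝ≥0∞)) fun l => ω.1 l i)
            (fun _ _ => zero_le) (Finset.mem_univ i)
  have hind : ∀ k i, Measurable fun x : ℕ → Fin s → ℝ =>
      (N (n + k)).indicator (fun _ => (1 : ℝ≥0∞)) fun l => x l i := fun k i =>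
    (measurable_const.indicator (hNm _)).comp
      (by fun_prop : Measurable fun (x : ℕ → Fin s → ℝ) l => x l i)
  have hsm : ∀ k, Measurable fun x : ℕ → Fin s → ℝ =>
      ∑ i : Fin s, (N (n + k)).indicator (fun _ => (1 : ℝ≥0∞)) fun l => x l i := fun k =>
    Finset.measurable_sum _ fun i _ => hind k i
  calc meanTime μ ν f g θ
      ≤ ∫⁻ ω, (n + ∑' k, ∑ i : Fin s,
          (N (n + k)).indicator (fun _ => (1 : ℝ≥0∞)) fun l => ω.1 l i) ∂jointLaw μ ν f g θ :=
        lintegral_mono hpt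
    _ = ∫⁻ x, (n + ∑' k, ∑ i : Fin s,
          (N (n + k)).indicator (fun _ => (1 : ℝ≥0∞)) fun l => x l i)
            ∂iidLaw s (stateLaw μ ν θ) :=
        (measurePreserving_jointLaw_fst f g θ).lintegral_comp
          (measurable_const.add (Measurable.tsum hsm))
    _ = n + ∑' k, ∑ i : Fin s, seqLaw (stateLaw μ ν θ) (N (n + k)) := by
        rw [lintegral_add_left measurable_const, lintegral_const, measure_univ, mul_one,
          lintegral_tsum fun k => (hsm k).aemeasurable]
        congr 1
        refine tsum_congr fun k => ?_
        rw [lintegral_finsetSum _ fun i _ => hind k i]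
        refine Finset.sum_congr rfl fun i _ => ?_
        have h1 := (measurePreserving_sensor (stateLaw μ ν θ) i).lintegral_comp
          ((measurable_const (a := (1 : ℝ≥0∞))).indicator (hNm (n + k)))
        rw [h1, lintegral_indicator_const (hNm _), one_mul]
        rfl
    _ = _ := by
        simp only [Finset.sum_const, Finset.card_univ, Fintype.card_fin, nsmul_eq_mul]
        rw [ENNReal.tsum_mul_left]

lemma exists_delay_voting_le (hμ : Integrable (llr μ ν) μ) (hν : Integrable (llr μ ν) ν)
    (hI0 : 0 < klZero μ ν) (hI1 : 0 < klOne μ ν) (h : 2 * c < s) {ε : ℝ} (hε : 0 < ε) :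
    ∃ B : ℝ, 0 < B ∧ ∀ M ≥ B, ∀ a ≤ M, ∀ b ≤ M, ∀ g : Attack s c,
      delay μ ν (votingDetector μ ν (s - c) a b) g ≤
        ENNReal.ofReal (M * ((min (klZero μ ν) (klOne μ ν))⁻¹ + ε)) := by
  have hs : (0 : ℝ) < s := by exact_mod_cast (Nat.zero_le _).trans_lt h
  have hmin : 0 < min (klZero μ ν) (klOne μ ν) := lt_min hI0 hI1
  have hθ : ∀ θ : Bool, ∃ B : ℝ, 0 < B ∧ ∀ M ≥ B, ∀ a ≤ M, ∀ b ≤ M, ∀ g : Attack s c,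
      meanTime μ ν (votingDetector μ ν (s - c) a b) g θ ≤
        ENNReal.ofReal (M * ((min (klZero μ ν) (klOne μ ν))⁻¹ + ε)) := by
    intro θ
    have hle := min_kl_le_integral_stateLLR (μ := μ) (ν := ν) θ
    have hm := hmin.trans_le hle
    -- The `s` excess times together use half of the slack `ε * M`; the other half pays for the
    -- rounding in `⌈M / m⌉₊`, since `M ≥ 2 / ε`.
    obtain ⟨B, hB, hBM⟩ := exists_tsum_notReached_le (measurable_stateLLR θ)
      (integrable_stateLLR hμ hν θ) hm (ε := ε / (2 * s)) (by positivity)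
    set m := ∫ x, stateLLR μ ν θ x ∂stateLaw μ ν θ
    refine ⟨max B (2 / ε), by positivity, fun M hM a ha b hb g => ?_⟩
    have hM1 : B ≤ M := (le_max_left _ _).trans hM
    have hM2 : 2 / ε ≤ M := (le_max_right _ _).trans hM
    have hM0 : 0 < M := hB.trans_le hM1
    have hthr : threshold a b θ ≤ M := by cases θ <;> assumption
    refine (meanTime_voting_le h g θ hthr ⌈M / m⌉₊).trans ?_
    have h1 : (s : ℝ≥0∞) = ENNReal.ofReal s := (ENNReal.ofReal_natCast s).symm
    have h2 : ((⌈M / m⌉₊ : ℕ) : ℝ≥0∞) = ENNReal.ofReal (⌈M / m⌉₊ : ℝ) :=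
      (ENNReal.ofReal_natCast _).symm
    calc ((⌈M / m⌉₊ : ℕ) : ℝ≥0∞) + s * ∑' k, seqLaw (stateLaw μ ν θ)
          (notReached (stateLLR μ ν θ) M (⌈M / m⌉₊ + k))
        ≤ (⌈M / m⌉₊ : ℕ) + s * ENNReal.ofReal (ε / (2 * s) * M) := by
          gcongr; exact hBM M hM1
      _ = ENNReal.ofReal (⌈M / m⌉₊ + s * (ε / (2 * s) * M)) := by
          rw [h1, h2, ← ENNReal.ofReal_mul hs.le, ← ENNReal.ofReal_add (by positivity)
            (by positivity)]
      _ ≤ _ := by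
          apply ENNReal.ofReal_le_ofReal
          have h3 := (Nat.ceil_lt_add_one (div_pos hM0 hm).le).le
          have h4 : M / m ≤ M * (min (klZero μ ν) (klOne μ ν))⁻¹ := by
            rw [div_eq_mul_inv]; gcongr
          have h5 : (s : ℝ) * (ε / (2 * s) * M) = ε / 2 * M := by field_simp
          have h6 : 1 ≤ ε / 2 * M := by
            rw [div_le_iff₀ hε] at hM2; linarith
          rw [h5, mul_add]
          linarith
  obtain ⟨B0, hB0, h0⟩ := hθ false
  obtain ⟨B1, hB1, h1⟩ := hθ true
  exact ⟨max B0 B1, by positivity, fun M hM a ha b hb g =>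
    max_le (h0 M ((le_max_left _ _).trans hM) a ha b hb g)
      (h1 M ((le_max_right _ _).trans hM) a ha b hb g)⟩

/-- The error bound at level `M` is a hypothesis so that the lemma serves both equal thresholds and
equal errors with `M` the larger threshold. -/
lemma exists_le_perfRatio_voting (hμ : Integrable (llr μ ν) μ) (hν : Integrable (llr μ ν) ν)
    (hI0 : 0 < klZero μ ν) (hI1 : 0 < klOne μ ν) (h : 2 * c < s) {w : ℝ≥0∞}
    (hw : w < gameValue μ ν s c) :
    ∃ B : ℝ, 0 < B ∧ ∀ M ≥ B, ∀ a ≤ M, ∀ b ≤ M, ∀ g : Attack s c,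
      0 < errorLevel μ ν (votingDetector μ ν (s - c) a b) g →
      errorLevel μ ν (votingDetector μ ν (s - c) a b) g ≤
        (s.choose (s - 2 * c) : ℝ) * Real.exp (-(((s : ℝ) - 2 * c) * M)) →
      w ≤ perfRatio μ ν (votingDetector μ ν (s - c) a b) g := by
  set I := min (klZero μ ν) (klOne μ ν) with hI
  have hIpos : 0 < I := lt_min hI0 hI1
  set r : ℝ := (s : ℝ) - 2 * c with hr
  have hrpos : 0 < r := by
    have : (2 * c : ℝ) < s := by exact_mod_cast h
    rw [hr]; linarith
  set C : ℝ := (s.choose (s - 2 * c) : ℝ) with hC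
  have hCpos : 0 < C := by
    rw [hC]; exact_mod_cast Nat.choose_pos (Nat.sub_le _ _)
  have hwtop : w ≠ ⊤ := hw.ne_top
  set q := w.toReal with hq
  have hq0 : 0 ≤ q := ENNReal.toReal_nonneg
  have hwq : w = ENNReal.ofReal q := (ENNReal.ofReal_toReal hwtop).symm
  have hqr : q * I⁻¹ < r := by
    rw [gameValue, hwq, ENNReal.ofReal_lt_ofReal_iff (mul_pos hrpos hIpos)] at hw
    rwa [← div_eq_mul_inv, div_lt_iff₀ hIpos]
  obtain ⟨ε, hε, hqε⟩ : ∃ ε : ℝ, 0 < ε ∧ q * (I⁻¹ + ε) < r := by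
    -- This `ε` uses at most half of the gap between `q * I⁻¹` and `r`; the `+ 1` covers `q = 0`.
    refine ⟨(r - q * I⁻¹) / (2 * (q + 1)), div_pos (by linarith) (by positivity), ?_⟩
    have h1 : q * ((r - q * I⁻¹) / (2 * (q + 1))) ≤ (r - q * I⁻¹) / 2 := by
      rw [← mul_div_assoc, div_le_div_iff₀ (by positivity) (by norm_num)]
      nlinarith
    rw [mul_add]
    linarith
  obtain ⟨B, hB, hdelay⟩ := exists_delay_voting_le hμ hν hI0 hI1 h hε
  set Δ := r - q * (I⁻¹ + ε) with hΔ
  have hΔpos : 0 < Δ := by rw [hΔ]; linarith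
  -- Beyond this level the remaining gap `M * Δ` absorbs the constant `log C` and leaves `1`, which
  -- keeps the numerator of the ratio positive.
  refine ⟨max B ((|Real.log C| + 1) / Δ), by positivity, fun M hM a ha b hb g hpos hle => ?_⟩
  have hM1 : B ≤ M := (le_max_left _ _).trans hM
  have hM0 : 0 < M := hB.trans_le hM1
  have hM2 : |Real.log C| + 1 ≤ M * Δ := (div_le_iff₀ hΔpos).1 ((le_max_right _ _).trans hM)
  have hD := hdelay M hM1 a ha b hb g
  have hlog : r * M - Real.log C ≤
      Real.log (1 / errorLevel μ ν (votingDetector μ ν (s - c) a b) g) := by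
    have h1 := Real.log_le_log hpos hle
    rw [Real.log_mul hCpos.ne' (Real.exp_pos _).ne', Real.log_exp] at h1
    rw [one_div, Real.log_inv]
    linarith
  have hkey : q * (M * (I⁻¹ + ε)) + 1 ≤
      Real.log (1 / errorLevel μ ν (votingDetector μ ν (s - c) a b) g) := by
    have h1 := le_abs_self (Real.log C)
    rw [hΔ] at hM2
    linarith
  have hqM : 0 ≤ q * (M * (I⁻¹ + ε)) := by positivity
  rw [perfRatio, ENNReal.le_div_iff_mul_le
    (Or.inr (ENNReal.ofReal_pos.2 (by linarith)).ne') (Or.inr ENNReal.ofReal_ne_top), hwq]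
  calc ENNReal.ofReal q * delay μ ν (votingDetector μ ν (s - c) a b) g
      ≤ ENNReal.ofReal q * ENNReal.ofReal (M * (I⁻¹ + ε)) := by gcongr
    _ = ENNReal.ofReal (q * (M * (I⁻¹ + ε))) := (ENNReal.ofReal_mul hq0).symm
    _ ≤ _ := ENNReal.ofReal_le_ofReal (by linarith)

/-- Otherwise `llr μ ν ≤ 0` almost everywhere for `ν`, hence for `μ`, which contradicts `I₁ > 0`. -/
lemma exists_measureReal_llr_pos {μ ν : Measure ℝ} [IsProbabilityMeasure ν] (hμν : μ ≪ ν) (hI1 : 0 < klOne μ ν) :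
    ∃ δ : ℝ, 0 < δ ∧ 0 < ν.real {y | δ ≤ llr μ ν y} := by
  by_contra! hcon
  have h1 : ∀ n : ℕ, ν {y | 1 / ((n : ℝ) + 1) ≤ llr μ ν y} = 0 := by
    intro n
    have h2 := hcon (1 / ((n : ℝ) + 1)) (by positivity)
    rw [← measureReal_eq_zero_iff]
    exact le_antisymm h2 measureReal_nonneg
  have h2 : ∀ᵐ y ∂ν, ∀ n : ℕ, llr μ ν y < 1 / ((n : ℝ) + 1) := by
    rw [ae_all_iff]
    intro n
    rw [ae_iff]
    simpa only [not_lt] using h1 n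
  have h3 : ∀ᵐ y ∂μ, llr μ ν y ≤ 0 := by
    filter_upwards [hμν.ae_le h2] with y hy
    exact ge_of_tendsto' tendsto_one_div_add_atTop_nhds_zero_nat fun n => (hy n).le
  exact absurd (integral_nonpos_of_ae h3) (not_le.2 hI1)

/-- The bound does not depend on `a` or on the attack; it shows that `α → 0` forces `b → ∞`. -/
lemma exists_pos_le_typeI_voting (hμν : μ ≪ ν) (hI1 : 0 < klOne μ ν) (h : 2 * c < s) (K : ℝ) :
    ∃ η : ℝ, 0 < η ∧ ∀ a > 0, ∀ b > 0, b ≤ K → ∀ g : Attack s c,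
      η ≤ typeI μ ν (votingDetector μ ν (s - c) a b) g := by
  obtain ⟨δ, hδ, hp⟩ := exists_measureReal_llr_pos hμν hI1
  refine ⟨(ν.real {y | δ ≤ llr μ ν y} ^ s) ^ ⌈K / δ⌉₊, by positivity, fun a ha b hb hbK g => ?_⟩
  refine le_acceptProb_voting h g ha hb true hδ ?_
  have h1 := Nat.le_ceil (K / δ)
  rw [div_le_iff₀ hδ] at h1
  exact hbK.trans h1

lemma errorLevel_voting_pos (hμν : μ ≪ ν) (hI1 : 0 < klOne μ ν) (h : 2 * c < s) {a b : ℝ}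
    (ha : 0 < a) (hb : 0 < b) (g : Attack s c) :
    0 < errorLevel μ ν (votingDetector μ ν (s - c) a b) g := by
  obtain ⟨η, hη, hle⟩ := exists_pos_le_typeI_voting hμν hI1 h b
  exact hη.trans_le ((hle a ha b hb le_rfl g).trans (le_max_left _ _))

lemma errorLevel_voting_le (hμν : μ ≪ ν) (hνμ : ν ≪ μ) (h : 2 * c < s) (a : ℝ)
    (g : Attack s c) :
    errorLevel μ ν (votingDetector μ ν (s - c) a a) g ≤
      (s.choose (s - 2 * c) : ℝ) * Real.exp (-(((s : ℝ) - 2 * c) * a)) :=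
  max_le (acceptProb_voting_le hμν hνμ h g a a true) (acceptProb_voting_le hμν hνμ h g a a false)

lemma tendsto_errorLevel_voting (hμν : μ ≪ ν) (hνμ : ν ≪ μ) (hI1 : 0 < klOne μ ν)
    (h : 2 * c < s) (g : Attack s c) :
    Tendsto (fun a : ℝ => errorLevel μ ν (votingDetector μ ν (s - c) a a) g) atTop (𝓝[>] 0) := by
  have hpos : ∀ᶠ a : ℝ in atTop, 0 < errorLevel μ ν (votingDetector μ ν (s - c) a a) g := by
    filter_upwards [eventually_gt_atTop 0] with a ha
    exact errorLevel_voting_pos hμν hI1 h ha ha g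
  refine tendsto_nhdsWithin_iff.2 ⟨?_, hpos⟩
  have hr : (0 : ℝ) < (s : ℝ) - 2 * c := by
    have : (2 * c : ℝ) < s := by exact_mod_cast h
    linarith
  have hlim : Tendsto (fun a : ℝ => (s.choose (s - 2 * c) : ℝ) *
      Real.exp (-(((s : ℝ) - 2 * c) * a))) atTop (𝓝 0) := by
    have h1 := Real.tendsto_exp_neg_atTop_nhds_zero.comp (tendsto_id.const_mul_atTop hr)
    simpa using h1.const_mul (s.choose (s - 2 * c) : ℝ)
  exact tendsto_of_tendsto_of_tendsto_of_le_of_le' tendsto_const_nhds hlim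
    (hpos.mono fun _ ha => ha.le)
    (Eventually.of_forall fun a => errorLevel_voting_le hμν hνμ h a g)

lemma le_liminf_perfRatio_voting_atTop (hμν : μ ≪ ν) (hνμ : ν ≪ μ)
    (hμ : Integrable (llr μ ν) μ) (hν : Integrable (llr μ ν) ν)
    (hI0 : 0 < klZero μ ν) (hI1 : 0 < klOne μ ν) (h : 2 * c < s) (g : Attack s c) :
    gameValue μ ν s c ≤
      liminf (fun a : ℝ => perfRatio μ ν (votingDetector μ ν (s - c) a a) g) atTop := by
  refine le_of_forall_lt fun w hw => ?_
  obtain ⟨w', hww', hw'⟩ := exists_between hw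
  obtain ⟨B, hB, hBM⟩ := exists_le_perfRatio_voting hμ hν hI0 hI1 h hw'
  refine hww'.trans_le (le_liminf_of_le (by isBoundedDefault) ?_)
  filter_upwards [eventually_ge_atTop B] with a ha
  exact hBM a ha a le_rfl a le_rfl g
    (errorLevel_voting_pos hμν hI1 h (hB.trans_le ha) (hB.trans_le ha) g)
    (errorLevel_voting_le hμν hνμ h a g)

lemma le_liminf_perfRatio_voting_equalErrors (hμν : μ ≪ ν) (hνμ : ν ≪ μ)
    (hμ : Integrable (llr μ ν) μ) (hν : Integrable (llr μ ν) ν)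
    (hI0 : 0 < klZero μ ν) (hI1 : 0 < klOne μ ν) (h : 2 * c < s) (g : Attack s c) :
    gameValue μ ν s c ≤ liminf (fun p => perfRatio μ ν (votingStrategy μ ν s c p) g)
      (equalErrors μ ν (votingStrategy μ ν s c) g) := by
  refine le_of_forall_lt fun w hw => ?_
  obtain ⟨w', hww', hw'⟩ := exists_between hw
  obtain ⟨B, hB, hBM⟩ := exists_le_perfRatio_voting hμ hν hI0 hI1 h hw'
  obtain ⟨η, hη, hle⟩ := exists_pos_le_typeI_voting hμν hI1 h B
  refine hww'.trans_le (le_liminf_of_le (by isBoundedDefault) ?_)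
  have hsmall : ∀ᶠ p in equalErrors μ ν (votingStrategy μ ν s c) g,
      typeI μ ν (votingStrategy μ ν s c p) g < η := by
    have h1 : ∀ᶠ e : ℝ in 𝓝[>] 0, e < η := mem_nhdsWithin_of_mem_nhds (Iio_mem_nhds hη)
    exact (tendsto_comap.mono_left inf_le_left).eventually h1
  have hequal : ∀ᶠ p in equalErrors μ ν (votingStrategy μ ν s c) g,
      typeI μ ν (votingStrategy μ ν s c p) g = typeII μ ν (votingStrategy μ ν s c p) g :=
    mem_inf_of_right (mem_principal_self _)
  filter_upwards [hsmall, hequal] with p hp hpe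
  obtain ⟨⟨a, b⟩, ha, hb⟩ := p
  have hBb : B ≤ b := by
    by_contra hcon
    exact absurd (hle a ha b hb (not_le.1 hcon).le g) (not_le.2 hp)
  refine hBM (max a b) (hBb.trans (le_max_right _ _)) a (le_max_left _ _) b (le_max_right _ _) g
    (errorLevel_voting_pos hμν hI1 h ha hb g) ?_
  have hI := acceptProb_voting_le hμν hνμ h g a b true
  have hII := acceptProb_voting_le hμν hνμ h g a b false
  change typeI μ ν (votingDetector μ ν (s - c) a b) g =
    typeII μ ν (votingDetector μ ν (s - c) a b) g at hpe
  rw [errorLevel, ← hpe, max_self]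
  -- The bound for `β` involves `a` and the bound for `α` involves `b`. As `α = β`, the bound with
  -- the larger threshold may be used.
  rcases max_choice a b with hab | hab <;> rw [hab]
  · rw [hpe]; exact hII
  · exact hI

end VotingPerformance

/-! ### The error level in the limit of equal errors. -/

section Limits

variable {μ ν : Measure ℝ} [IsProbabilityMeasure μ] [IsProbabilityMeasure ν] {s c : ℕ}

lemma tendsto_errorLevel_equalErrors {P : Type*} (f : P → Detector s) (g : Attack s c) :
    Tendsto (fun p => errorLevel μ ν (f p) g) (equalErrors μ ν f g) (𝓝[>] 0) := by
  have h : Tendsto (fun p => typeI μ ν (f p) g) (equalErrors μ ν f g) (𝓝[>] 0) :=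
    tendsto_comap.mono_left inf_le_left
  refine h.congr' ?_
  have hequal : ∀ᶠ p in equalErrors μ ν f g, typeI μ ν (f p) g = typeII μ ν (f p) g :=
    mem_inf_of_right (mem_principal_self _)
  filter_upwards [hequal] with p hp
  rw [errorLevel, ← hp, max_self]

end Limits

end ByzantineDetection

/-! ### The Nash equilibrium. -/

theorem theorem3 (μ ν : Measure ℝ) [IsProbabilityMeasure μ] [IsProbabilityMeasure ν]
    (hμν : μ ≪ ν) (hνμ : ν ≪ μ)
    (hint_mu : Integrable (llr μ ν) μ) (hint_nu : Integrable (llr μ ν) ν)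
    (hI0 : 0 < klZero μ ν) (hI1 : 0 < klOne μ ν)
    (s c : ℕ) (hsc : 2 * c < s) :
    -- the equilibrium in the limit `α = β → 0⁺`
    ((∀ {P : Type*} (f : P → Detector s),
        limsup (fun p => perfRatio μ ν (f p) (flipAttack μ ν hsc))
          (equalErrors μ ν f (flipAttack μ ν hsc)) ≤ gameValue μ ν s c) ∧
      Tendsto (fun p => perfRatio μ ν (votingStrategy μ ν s c p) (flipAttack μ ν hsc))
        (equalErrors μ ν (votingStrategy μ ν s c) (flipAttack μ ν hsc)) (𝓝 (gameValue μ ν s c)) ∧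
      ∀ g : Attack s c,
        gameValue μ ν s c ≤ liminf (fun p => perfRatio μ ν (votingStrategy μ ν s c p) g)
          (equalErrors μ ν (votingStrategy μ ν s c) g)) ∧
    -- the same with `max α β → 0⁺` for all detectors and equal thresholds for the voting detector
    ((∀ {P : Type*} (f : P → Detector s),
        limsup (fun p => perfRatio μ ν (f p) (flipAttack μ ν hsc))
          (smallErrors μ ν f (flipAttack μ ν hsc)) ≤ gameValue μ ν s c) ∧
      Tendsto (fun a : ℝ =>
          perfRatio μ ν (votingDetector μ ν (s - c) a a) (flipAttack μ ν hsc))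
        atTop (𝓝 (gameValue μ ν s c)) ∧
      ∀ g : Attack s c,
        Tendsto (fun a : ℝ => errorLevel μ ν (votingDetector μ ν (s - c) a a) g)
          atTop (𝓝[>] 0) ∧
        gameValue μ ν s c ≤ liminf (fun a : ℝ => perfRatio μ ν (votingDetector μ ν (s - c) a a) g)
          atTop) := by
  refine ⟨⟨fun f => limsup_perfRatio_flipAttack_le hμν hνμ hint_mu hint_nu hI0 hI1 hsc f
      (tendsto_errorLevel_equalErrors f _), ?_,
    le_liminf_perfRatio_voting_equalErrors hμν hνμ hint_mu hint_nu hI0 hI1 hsc⟩,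
    fun f => limsup_perfRatio_flipAttack_le hμν hνμ hint_mu hint_nu hI0 hI1 hsc f
      tendsto_comap, ?_, fun g =>
      ⟨tendsto_errorLevel_voting hμν hνμ hI1 hsc g,
        le_liminf_perfRatio_voting_atTop hμν hνμ hint_mu hint_nu hI0 hI1 hsc g⟩⟩
  -- The lower bound against every attack and the upper bound for every detector meet at the pair of
  -- voting and flipping.
  · exact tendsto_of_le_liminf_of_limsup_le
      (le_liminf_perfRatio_voting_equalErrors hμν hνμ hint_mu hint_nu hI0 hI1 hsc _)
      (limsup_perfRatio_flipAttack_le hμν hνμ hint_mu hint_nu hI0 hI1 hsc _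
        (tendsto_errorLevel_equalErrors _ _))
  · exact tendsto_of_le_liminf_of_limsup_le
      (le_liminf_perfRatio_voting_atTop hμν hνμ hint_mu hint_nu hI0 hI1 hsc _)
      (limsup_perfRatio_flipAttack_le hμν hνμ hint_mu hint_nu hI0 hI1 hsc _
        (tendsto_errorLevel_voting hμν hνμ hI1 hsc _))
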